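/- A PROP is a strict symmetric monoidal category whose monoid of objects is $(\mathbb N,+,0)$; $\mathsf{Perm}$ is the initial PROP (its arrows are the permutations). Composition $f\,;g$ is in diagrammatic order. For PROPs $T,S$, let $T\otimes S$ be the span $\mathbb N\leftarrow\cdot\rightarrow\mathbb N$ of monoids whose elements $[f,g]$ are composable pairs of an arrow $f$ of $T$ followed by an arrow $g$ of $S$, modulo the congruence generated by $(f\,;p,\,g)\sim(f,\,p\,;g)$ for permutations $p$ (with componentwise $\oplus$). A distributive law $\lambda:T\otimes S\to S\otimes T$ is a morphism of spans of monoids over $\mathbb N$ which commutes with the left and right actions of $\mathsf{Perm}$ and is compatible with units and multiplications: $\lambda[f,\mathrm{id}]=[\mathrm{id},f]$ and $\lambda[\mathrm{id},g]=[g,\mathrm{id}]$; if $\lambda[f,g]=[g_1,f_1]$ and $\lambda[f_1,g']=[g_2,f_2]$ then $\lambda[f,g\,;g']=[g_1\,;g_2,f_2]$; if $\lambda[f',g]=[g_1,f_1]$ and $\lambda[f,g_1]=[g_2,f_2]$ then $\lambda[f\,;f',g]=[g_2,f_2\,;f_1]$. If $T$ is generated by $(\Sigma,E)$ and $S$ is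 presented by $(\Sigma_S,E_S)$, the set $E_\lambda$ of equations encoded by $\lambda$ consists of all equations $s\,;t\approx t'\,;s'$ between $(\Sigma\uplus\Sigma_S)$-terms, with $s,s'$ $\Sigma$-terms and $t,t'$ $\Sigma_S$-terms, such that $\lambda$ maps $[s,t]$ to $[t',s']$ (terms standing for the arrows they denote). **Proposition.** Let $T$ be the PROP freely generated by a symmetric monoidal theory $(\Sigma,E)$, let $E'\supseteq E$ be another set of equations between $\Sigma$-terms, let $T'$ be the PROP generated by $(\Sigma,E')$ and $q:T\to T'$ the quotient morphism. Let $S$ be a PROP and $\lambda:T\otimes S\to S\otimes T$ a distributive law. 1. Suppose that $\lambda[c,e]=\lambda[d,e]$ in $S\otimes T$ whenever $c,d$ are $\Sigma$-terms such that $E'$ implies $c=d$, and $e$ is an arrow of $S$ composable with them. Then there is a distributive law $\lambda':T'\otimes S\to S\otimes T'$ induced by $\lambda$, i.e. $\lambda'\circ(q\otimes S)=(S\otimes q)\circ\lambda$, and it is presented by the same equations: $E_{\lambda'}=E_\lambda$ for every presentation $(\Sigma_S,E_S)$ of $S$. 2. Suppose only that the two results agree modulo $E'$, i.e. $(S\otimes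 q)(\lambda[c,e])=(S\otimes q)(\lambda[d,e])$ in $S\otimes T'$ for all such $c,d,e$. Then there is still a distributive law $\lambda':T'\otimes S\to S\otimes T'$ with $\lambda'\circ(q\otimes S)=(S\otimes q)\circ\lambda$, and for every presentation $(\Sigma_S,E_S)$ of $S$ the sets $E_{\lambda'}$ and $E_\lambda$ are the same sets of equations between $(\Sigma\uplus\Sigma_S)$-terms modulo $E'\uplus E_S$. -/

import Mathlib

universe u v w

namespace PROPTheory

/-! ### PROPs

Arrows of a PROP are kept in one type, with source and target maps to `ℕ`: a PROP is a span
`ℕ ← Arr → ℕ` of monoids (the addition of `Arr` is the monoidal product `⊕` of arrows, it is not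
assumed commutative) with identities and composition (a monad on that span, that is, a strict
monoidal category with object monoid `ℕ`), together with symmetries. Composition is written in
diagrammatic order. -/

/-- A PROP: a strict symmetric monoidal category whose monoid of objects is `(ℕ, +, 0)`. -/
structure PROP : Type (u + 1) where
  Arr : Type u
  [addMonoid : AddMonoid Arr]
  dom : Arr →+ ℕ
  cod : Arr →+ ℕ
  /-- identities; being a monoid homomorphism says `id_m ⊕ id_n = id_(m+n)` and `id_0 = 0` -/
  idn : ℕ →+ Arr
  dom_idn : ∀ n, dom (idn n) = n
  cod_idn : ∀ n, cod (idn n) = n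
  comp : ∀ f g : Arr, cod f = dom g → Arr
  dom_comp : ∀ f g h, dom (comp f g h) = dom f
  cod_comp : ∀ f g h, cod (comp f g h) = cod g
  idn_comp : ∀ (n : ℕ) (f : Arr) (h : cod (idn n) = dom f), comp (idn n) f h = f
  comp_idn : ∀ (n : ℕ) (f : Arr) (h : cod f = dom (idn n)), comp f (idn n) h = f
  comp_assoc : ∀ (f g k : Arr) (h₁ : cod f = dom g) (h₂ : cod g = dom k),
    comp (comp f g h₁) k ((cod_comp f g h₁).trans h₂) =
      comp f (comp g k h₂) (h₁.trans (dom_comp g k h₂).symm)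
  interchange : ∀ (f g f' g' : Arr) (h : cod f = dom g) (h' : cod f' = dom g')
    (h'' : cod (f + f') = dom (g + g')),
    comp (f + f') (g + g') h'' = comp f g h + comp f' g' h'
  /-- the symmetry `m + n → n + m` -/
  sym : ℕ → ℕ → Arr
  dom_sym : ∀ m n, dom (sym m n) = m + n
  cod_sym : ∀ m n, cod (sym m n) = n + m
  sym_natural : ∀ (f g : Arr) (h : cod (f + g) = dom (sym (cod f) (cod g)))
    (h' : cod (sym (dom f) (dom g)) = dom (g + f)),
    comp (f + g) (sym (cod f) (cod g)) h = comp (sym (dom f) (dom g)) (g + f) h'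
  sym_sym : ∀ (m n : ℕ) (h : cod (sym m n) = dom (sym n m)),
    comp (sym m n) (sym n m) h = idn (m + n)
  sym_zero : ∀ m, sym m 0 = idn m
  sym_add : ∀ (m n k : ℕ) (h : cod (sym m n + idn k) = dom (idn n + sym m k)),
    sym m (n + k) = comp (sym m n + idn k) (idn n + sym m k) h

attribute [instance] PROP.addMonoid

/-- Morphisms of PROPs: identity-on-objects strict symmetric monoidal functors. -/
structure PROPHom (P : PROP.{u}) (Q : PROP.{v}) where
  toHom : P.Arr →+ Q.Arr
  map_dom : ∀ f, Q.dom (toHom f) = P.dom f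
  map_cod : ∀ f, Q.cod (toHom f) = P.cod f
  map_idn : ∀ n, toHom (P.idn n) = Q.idn n
  map_comp : ∀ (f g : P.Arr) (h : P.cod f = P.dom g) (h' : Q.cod (toHom f) = Q.dom (toHom g)),
    toHom (P.comp f g h) = Q.comp (toHom f) (toHom g) h'
  map_sym : ∀ m n, toHom (P.sym m n) = Q.sym m n

/-- The identity morphism. -/
def PROPHom.refl (P : PROP.{u}) : PROPHom P P where
  toHom := AddMonoidHom.id _
  map_dom _ := rfl
  map_cod _ := rfl
  map_idn _ := rfl
  map_comp _ _ _ _ := rfl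
  map_sym _ _ := rfl

/-! ### Symmetric monoidal theories and the PROPs they generate -/

/-- A signature: `Sg n m` is the set of generators with arity `n` and coarity `m`. -/
abbrev Signature : Type (u + 1) := ℕ → ℕ → Type u

/-- Disjoint union of signatures. -/
abbrev Signature.sum (Sg : Signature.{u}) (Sg' : Signature.{v}) : Signature.{max u v} :=
  fun n m => Sg n m ⊕ Sg' n m

/-- `Sg`-terms `n → m`. -/
inductive Term (Sg : Signature.{u}) : ℕ → ℕ → Type u
  | gen {n m : ℕ} (s : Sg n m) : Term Sg n m
  | idn (n : ℕ) : Term Sg n n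
  | sym (m n : ℕ) : Term Sg (m + n) (n + m)
  | comp {a b b' c : ℕ} (f : Term Sg a b) (g : Term Sg b' c) (h : b = b') : Term Sg a c
  | tensor {a b c d : ℕ} (f : Term Sg a b) (g : Term Sg c d) : Term Sg (a + c) (b + d)

/-- An equation between two `Sg`-terms of the same arity and coarity. -/
structure Equation (Sg : Signature.{u}) : Type u where
  src : ℕ
  tgt : ℕ
  lhs : Term Sg src tgt
  rhs : Term Sg src tgt

/-- `Prov E s t`: the equations `E` imply `s = t`, that is, `(s, t)` lies in the smallest
congruence containing `E` and the laws of strict symmetric monoidal categories. The types of the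
two sides are left independent, because the two sides of, e.g., associativity of `⊕` have types
that agree only up to an equation of natural numbers (they always do agree, see `Prov.typ`). -/
inductive Prov {Sg : Signature.{u}} (E : Set (Equation Sg)) :
    ∀ {a b c d : ℕ}, Term Sg a b → Term Sg c d → Prop
  | ax (e : Equation Sg) (h : e ∈ E) : Prov E e.lhs e.rhs
  | refl {a b : ℕ} (f : Term Sg a b) : Prov E f f
  | symm {a b c d : ℕ} {f : Term Sg a b} {g : Term Sg c d} (h : Prov E f g) : Prov E g f
  | trans {a b c d a' b' : ℕ} {f : Term Sg a b} {g : Term Sg c d} {k : Term Sg a' b'}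
      (h : Prov E f g) (h' : Prov E g k) : Prov E f k
  | comp_congr {a b b' c a₁ b₁ b₁' c₁ : ℕ} {f : Term Sg a b} {g : Term Sg b' c}
      {f₁ : Term Sg a₁ b₁} {g₁ : Term Sg b₁' c₁} (h : b = b') (h₁ : b₁ = b₁')
      (hf : Prov E f f₁) (hg : Prov E g g₁) : Prov E (f.comp g h) (f₁.comp g₁ h₁)
  | tensor_congr {a b c d a₁ b₁ c₁ d₁ : ℕ} {f : Term Sg a b} {g : Term Sg c d}
      {f₁ : Term Sg a₁ b₁} {g₁ : Term Sg c₁ d₁}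
      (hf : Prov E f f₁) (hg : Prov E g g₁) : Prov E (f.tensor g) (f₁.tensor g₁)
  | idn_comp {n a b : ℕ} (f : Term Sg a b) (h : n = a) : Prov E ((Term.idn n).comp f h) f
  | comp_idn {n a b : ℕ} (f : Term Sg a b) (h : b = n) : Prov E (f.comp (Term.idn n) h) f
  | comp_assoc {a b b' c c' d : ℕ} (f : Term Sg a b) (g : Term Sg b' c) (k : Term Sg c' d)
      (h : b = b') (h' : c = c') : Prov E ((f.comp g h).comp k h') (f.comp (g.comp k h') h)
  | tensor_assoc {a b c d a' b' : ℕ} (f : Term Sg a b) (g : Term Sg c d) (k : Term Sg a' b') :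
      Prov E ((f.tensor g).tensor k) (f.tensor (g.tensor k))
  | zero_tensor {a b : ℕ} (f : Term Sg a b) : Prov E ((Term.idn 0).tensor f) f
  | tensor_zero {a b : ℕ} (f : Term Sg a b) : Prov E (f.tensor (Term.idn 0)) f
  | idn_tensor (m n : ℕ) : Prov E ((Term.idn m).tensor (Term.idn n)) (Term.idn (m + n))
  | interchange {a b b' c a₁ b₁ b₁' c₁ : ℕ} (f : Term Sg a b) (g : Term Sg b' c)
      (f₁ : Term Sg a₁ b₁) (g₁ : Term Sg b₁' c₁) (h : b = b') (h₁ : b₁ = b₁')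
      (h₂ : b + b₁ = b' + b₁') :
      Prov E ((f.tensor f₁).comp (g.tensor g₁) h₂) ((f.comp g h).tensor (f₁.comp g₁ h₁))
  | sym_natural {a b c d : ℕ} (f : Term Sg a b) (g : Term Sg c d) :
      Prov E ((f.tensor g).comp (Term.sym b d) rfl) ((Term.sym a c).comp (g.tensor f) rfl)
  | sym_sym (m n : ℕ) : Prov E ((Term.sym m n).comp (Term.sym n m) rfl) (Term.idn (m + n))
  | sym_zero (m : ℕ) : Prov E (Term.sym m 0) (Term.idn m)
  | sym_add (m n k : ℕ) :
      Prov E (Term.sym m (n + k))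
        (((Term.sym m n).tensor (Term.idn k)).comp ((Term.idn n).tensor (Term.sym m k))
          (add_assoc n m k))

theorem Prov.typ {Sg : Signature.{u}} {E : Set (Equation Sg)} {a b c d : ℕ}
    {f : Term Sg a b} {g : Term Sg c d} (h : Prov E f g) : a = c ∧ b = d := by
  induction h <;> omega

theorem Prov.mono {Sg : Signature.{u}} {E E' : Set (Equation Sg)} (hE : E ⊆ E') {a b c d : ℕ}
    {f : Term Sg a b} {g : Term Sg c d} (h : Prov E f g) : Prov E' f g := by
  induction h with
  | ax e h => exact .ax e (hE h)
  | refl f => exact .refl f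
  | symm _ ih => exact .symm ih
  | trans _ _ ih ih' => exact .trans ih ih'
  | comp_congr h h₁ _ _ ih ih' => exact .comp_congr h h₁ ih ih'
  | tensor_congr _ _ ih ih' => exact .tensor_congr ih ih'
  | idn_comp f h => exact .idn_comp f h
  | comp_idn f h => exact .comp_idn f h
  | comp_assoc f g k h h' => exact .comp_assoc f g k h h'
  | tensor_assoc f g k => exact .tensor_assoc f g k
  | zero_tensor f => exact .zero_tensor f
  | tensor_zero f => exact .tensor_zero f
  | idn_tensor m n => exact .idn_tensor m n
  | interchange f g f₁ g₁ h h₁ h₂ => exact .interchange f g f₁ g₁ h h₁ h₂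
  | sym_natural f g => exact .sym_natural f g
  | sym_sym m n => exact .sym_sym m n
  | sym_zero m => exact .sym_zero m
  | sym_add m n k => exact .sym_add m n k

/-- A term together with its arity and coarity. -/
structure STerm (Sg : Signature.{u}) : Type u where
  src : ℕ
  tgt : ℕ
  term : Term Sg src tgt

/-- Equality modulo `E`. -/
def provSetoid {Sg : Signature.{u}} (E : Set (Equation Sg)) : Setoid (STerm Sg) where
  r s t := Prov E s.term t.term
  iseqv := ⟨fun s => .refl s.term, fun h => .symm h, fun h h' => .trans h h'⟩

/-- Arrows of the PROP generated by `(Sg, E)`: terms modulo `E` and the laws of strict symmetric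
monoidal categories. -/
def PArr (Sg : Signature.{u}) (E : Set (Equation Sg)) : Type u := Quotient (provSetoid E)

/-- The class of a term modulo `E`. -/
def PArr.mk {Sg : Signature.{u}} (E : Set (Equation Sg)) {a b : ℕ} (t : Term Sg a b) : PArr Sg E :=
  Quotient.mk (provSetoid E) ⟨a, b, t⟩

theorem PArr.mk_eq {Sg : Signature.{u}} {E : Set (Equation Sg)} {a b c d : ℕ} {s : Term Sg a b}
    {t : Term Sg c d} : PArr.mk E s = PArr.mk E t ↔ Prov E s t :=
  Quotient.eq (r := provSetoid E)

theorem PArr.ind {Sg : Signature.{u}} {E : Set (Equation Sg)} {P : PArr Sg E → Prop}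
    (h : ∀ {a b : ℕ} (t : Term Sg a b), P (PArr.mk E t)) (x : PArr Sg E) : P x :=
  Quotient.ind (fun s => h s.term) x

instance {Sg : Signature.{u}} {E : Set (Equation Sg)} : Add (PArr Sg E) where
  add := Quotient.map₂ (fun s t => ⟨_, _, s.term.tensor t.term⟩)
    (fun _ _ h _ _ h' => Prov.tensor_congr h h')

instance {Sg : Signature.{u}} {E : Set (Equation Sg)} : Zero (PArr Sg E) where
  zero := PArr.mk E (.idn 0)

instance {Sg : Signature.{u}} {E : Set (Equation Sg)} : AddMonoid (PArr Sg E) where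
  add_assoc x y z := by
    induction x using PArr.ind; induction y using PArr.ind; induction z using PArr.ind
    exact PArr.mk_eq.2 (.tensor_assoc _ _ _)
  zero_add x := by
    induction x using PArr.ind; exact PArr.mk_eq.2 (.zero_tensor _)
  add_zero x := by
    induction x using PArr.ind; exact PArr.mk_eq.2 (.tensor_zero _)
  nsmul := nsmulRec

theorem PArr.mk_add {Sg : Signature.{u}} {E : Set (Equation Sg)} {a b c d : ℕ} (s : Term Sg a b)
    (t : Term Sg c d) : PArr.mk E s + PArr.mk E t = PArr.mk E (s.tensor t) := rfl

/-- Arity of a class of terms. -/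
def PArr.dom {Sg : Signature.{u}} {E : Set (Equation Sg)} : PArr Sg E →+ ℕ where
  toFun := Quotient.lift STerm.src fun _ _ h => (Prov.typ h).1
  map_zero' := rfl
  map_add' x y := by
    induction x using PArr.ind; induction y using PArr.ind; rfl

/-- Coarity of a class of terms. -/
def PArr.cod {Sg : Signature.{u}} {E : Set (Equation Sg)} : PArr Sg E →+ ℕ where
  toFun := Quotient.lift STerm.tgt fun _ _ h => (Prov.typ h).2
  map_zero' := rfl
  map_add' x y := by
    induction x using PArr.ind; induction y using PArr.ind; rfl

/-- Composition of classes of terms: composition of representatives (the value on classes that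
are not composable is a dummy, which `presented` below never uses). -/
def PArr.comp {Sg : Signature.{u}} {E : Set (Equation Sg)} : PArr Sg E → PArr Sg E → PArr Sg E :=
  Quotient.map₂ (fun s t => if h : s.tgt = t.src then ⟨_, _, s.term.comp t.term h⟩ else s)
    (fun s s₁ h t t₁ h' => by
      have e : s.tgt = t.src ↔ s₁.tgt = t₁.src := by
        have h1 := (Prov.typ h).2
        have h2 := (Prov.typ h').1
        rw [h1, h2]
      by_cases hc : s.tgt = t.src
      · have hc₁ := e.1 hc
        rw [dif_pos hc, dif_pos hc₁]
        exact Prov.comp_congr hc hc₁ h h'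
      · have hc₁ := fun k => hc (e.2 k)
        rw [dif_neg hc, dif_neg hc₁]
        exact h)

theorem PArr.mk_comp {Sg : Signature.{u}} {E : Set (Equation Sg)} {a b b' c : ℕ} (s : Term Sg a b)
    (t : Term Sg b' c) (h : b = b') :
    PArr.comp (PArr.mk E s) (PArr.mk E t) = PArr.mk E (s.comp t h) := by
  change Quotient.mk (provSetoid E) (dite (b = b') _ _) = _
  rw [dif_pos h]; rfl

theorem PArr.mk_comp_of {Sg : Signature.{u}} {E : Set (Equation Sg)} {a b b' c : ℕ}
    (s : Term Sg a b) (t : Term Sg b' c) (h : PArr.cod (PArr.mk E s) = PArr.dom (PArr.mk E t)) :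
    PArr.comp (PArr.mk E s) (PArr.mk E t) = PArr.mk E (s.comp t h) := PArr.mk_comp s t h

/-- The PROP generated (presented) by the symmetric monoidal theory `(Sg, E)`. -/
def presented (Sg : Signature.{u}) (E : Set (Equation Sg)) : PROP.{u} where
  Arr := PArr Sg E
  dom := PArr.dom
  cod := PArr.cod
  idn :=
    { toFun := fun n => PArr.mk E (.idn n)
      map_zero' := rfl
      map_add' := fun m n => PArr.mk_eq.2 (Prov.symm (.idn_tensor m n)) }
  dom_idn _ := rfl
  cod_idn _ := rfl
  comp f g _ := PArr.comp f g
  dom_comp f g h := by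
    induction f using PArr.ind; induction g using PArr.ind
    rw [PArr.mk_comp_of _ _ h]; rfl
  cod_comp f g h := by
    induction f using PArr.ind; induction g using PArr.ind
    rw [PArr.mk_comp_of _ _ h]; rfl
  idn_comp n f h := by
    induction f using PArr.ind
    exact (PArr.mk_comp_of _ _ h).trans (PArr.mk_eq.2 (.idn_comp _ _))
  comp_idn n f h := by
    induction f using PArr.ind
    exact (PArr.mk_comp_of _ _ h).trans (PArr.mk_eq.2 (.comp_idn _ _))
  comp_assoc f g k h₁ h₂ := by
    induction f using PArr.ind; induction g using PArr.ind; induction k using PArr.ind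
    refine (congrArg (PArr.comp · _) (PArr.mk_comp_of _ _ h₁)).trans ?_
    refine Eq.trans ?_ (congrArg (PArr.comp _ ·) (PArr.mk_comp_of _ _ h₂)).symm
    exact (PArr.mk_comp _ _ h₂).trans
      ((PArr.mk_eq.2 (.comp_assoc _ _ _ _ _)).trans (PArr.mk_comp _ _ h₁).symm)
  interchange f g f' g' h h' h'' := by
    induction f using PArr.ind; induction g using PArr.ind
    induction f' using PArr.ind; induction g' using PArr.ind
    refine Eq.trans ?_
      (congrArg₂ (· + ·) (PArr.mk_comp_of _ _ h) (PArr.mk_comp_of _ _ h')).symm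
    exact (PArr.mk_comp _ _ h'').trans (PArr.mk_eq.2 (.interchange _ _ _ _ _ _ _))
  sym m n := PArr.mk E (.sym m n)
  dom_sym _ _ := rfl
  cod_sym _ _ := rfl
  sym_natural f g h h' := by
    induction f using PArr.ind; induction g using PArr.ind
    exact (PArr.mk_comp _ _ rfl).trans
      ((PArr.mk_eq.2 (.sym_natural _ _)).trans (PArr.mk_comp _ _ rfl).symm)
  sym_sym m n h := (PArr.mk_comp _ _ rfl).trans (PArr.mk_eq.2 (.sym_sym m n))
  sym_zero m := PArr.mk_eq.2 (.sym_zero m)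
  sym_add m n k h :=
    (PArr.mk_eq.2 (.sym_add m n k)).trans (PArr.mk_comp _ _ (add_assoc n m k)).symm

/-- The arrow of the PROP generated by `(Sg, E)` that a term denotes. -/
def cls {Sg : Signature.{u}} (E : Set (Equation Sg)) {a b : ℕ} (t : Term Sg a b) :
    (presented Sg E).Arr := PArr.mk E t

/-- The quotient morphism between the PROPs generated by `(Sg, E)` and `(Sg, E')`, for `E ⊆ E'`. -/
def quotHom {Sg : Signature.{u}} {E E' : Set (Equation Sg)} (hE : E ⊆ E') :
    PROPHom (presented Sg E) (presented Sg E') where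
  toHom :=
    { toFun := Quotient.map (fun s => s) (fun _ _ h => Prov.mono hE h)
      map_zero' := rfl
      map_add' := fun x y => by
        induction x using PArr.ind; induction y using PArr.ind; rfl }
  map_dom f := by induction f using PArr.ind; rfl
  map_cod f := by induction f using PArr.ind; rfl
  map_idn _ := rfl
  map_comp f g h h' := by
    induction f using PArr.ind; induction g using PArr.ind
    refine (congrArg _ (PArr.mk_comp_of _ _ h)).trans ?_
    exact (PArr.mk_comp _ _ h).symm
  map_sym _ _ := rfl

/-- `P` is presented by the theory `(Sg, E)`: it is isomorphic to the PROP generated by it. -/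
structure PresentedBy (P : PROP.{v}) (Sg : Signature.{u}) (E : Set (Equation Sg)) where
  hom : PROPHom (presented Sg E) P
  bijective : Function.Bijective hom.toHom

/-! ### The PROP of permutations -/

/-- Evaluation in a PROP of terms without generators. -/
def evalPerm (P : PROP.{v}) : ∀ {a b : ℕ}, Term (fun _ _ => Empty) a b →
    {x : P.Arr // P.dom x = a ∧ P.cod x = b}
  | _, _, .gen s => s.elim
  | _, _, .idn n => ⟨P.idn n, P.dom_idn n, P.cod_idn n⟩
  | _, _, .sym m n => ⟨P.sym m n, P.dom_sym m n, P.cod_sym m n⟩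
  | _, _, .comp f g h =>
    ⟨P.comp (evalPerm P f).1 (evalPerm P g).1
      ((evalPerm P f).2.2.trans (h.trans (evalPerm P g).2.1.symm)),
      (P.dom_comp _ _ _).trans (evalPerm P f).2.1, (P.cod_comp _ _ _).trans (evalPerm P g).2.2⟩
  | _, _, .tensor f g =>
    ⟨(evalPerm P f).1 + (evalPerm P g).1,
      by rw [map_add, (evalPerm P f).2.1, (evalPerm P g).2.1],
      by rw [map_add, (evalPerm P f).2.2, (evalPerm P g).2.2]⟩

theorem PROP.comp_congr (P : PROP.{v}) {f f' g g' : P.Arr} (hf : f = f') (hg : g = g')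
    (h : P.cod f = P.dom g) (h' : P.cod f' = P.dom g') : P.comp f g h = P.comp f' g' h' := by
  subst hf; subst hg; rfl

theorem evalPerm_sound (P : PROP.{v}) {a b c d : ℕ} {s : Term (fun _ _ => Empty) a b}
    {t : Term (fun _ _ => Empty) c d} (h : Prov ∅ s t) :
    (evalPerm P s).1 = (evalPerm P t).1 := by
  induction h with
  | ax e h => exact h.elim
  | refl f => rfl
  | symm _ ih => exact ih.symm
  | trans _ _ ih ih' => exact ih.trans ih'
  | comp_congr h h₁ _ _ ih ih' => exact P.comp_congr ih ih' _ _
  | tensor_congr _ _ ih ih' => exact congrArg₂ (· + ·) ih ih'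
  | idn_comp f h => exact P.idn_comp _ _ _
  | comp_idn f h => exact P.comp_idn _ _ _
  | comp_assoc f g k h h' => exact P.comp_assoc _ _ _ _ _
  | tensor_assoc f g k => exact add_assoc _ _ _
  | zero_tensor f => simp [evalPerm]
  | tensor_zero f => simp [evalPerm]
  | idn_tensor m n => exact (map_add P.idn m n).symm
  | interchange f g f₁ g₁ h h₁ h₂ => exact P.interchange _ _ _ _ _ _ _
  | sym_natural f g =>
    have hf := (evalPerm P f).2
    have hg := (evalPerm P g).2
    have h₁ : P.cod ((evalPerm P f).1 + (evalPerm P g).1) =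
        P.dom (P.sym (P.cod (evalPerm P f).1) (P.cod (evalPerm P g).1)) := by
      rw [map_add, P.dom_sym]
    have h₂ : P.cod (P.sym (P.dom (evalPerm P f).1) (P.dom (evalPerm P g).1)) =
        P.dom ((evalPerm P g).1 + (evalPerm P f).1) := by
      rw [map_add, P.cod_sym]
    exact (P.comp_congr rfl (by rw [hf.2, hg.2]; rfl) _ h₁).trans
      ((P.sym_natural (evalPerm P f).1 (evalPerm P g).1 h₁ h₂).trans
        (P.comp_congr (by rw [hf.1, hg.1]; rfl) rfl _ _))
  | sym_sym m n => exact P.sym_sym _ _ _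
  | sym_zero m => exact P.sym_zero m
  | sym_add m n k => exact P.sym_add _ _ _ _

/-- The PROP of permutations: the initial PROP, realised as the PROP generated by the empty
theory. Its arrows `n → n` are the permutations written as composites of symmetries. -/
def Perm : PROP.{0} := presented (fun _ _ => Empty) ∅

/-- The (unique) morphism from the PROP of permutations to a PROP. -/
def permHom (P : PROP.{v}) : PROPHom Perm P where
  toHom :=
    { toFun := Quotient.lift (fun s : STerm (fun _ _ => Empty) => (evalPerm P s.term).1)
        (fun _ _ h => evalPerm_sound P h)
      map_zero' := map_zero P.idn
      map_add' := fun x y => by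
        induction x using PArr.ind; induction y using PArr.ind; rfl }
  map_dom f := by induction f using PArr.ind with | h t => exact (evalPerm P t).2.1
  map_cod f := by induction f using PArr.ind with | h t => exact (evalPerm P t).2.2
  map_idn _ := rfl
  map_comp f g h h' := by
    induction f using PArr.ind; induction g using PArr.ind
    exact congrArg _ (PArr.mk_comp_of _ _ h)
  map_sym _ _ := rfl

theorem permHom_unique {P : PROP.{v}} (φ : PROPHom Perm P) (p : Perm.Arr) :
    φ.toHom p = (permHom P).toHom p := by
  induction p using PArr.ind with
  | h t =>
    induction t with
    | gen s => exact s.elim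
    | idn n => exact (φ.map_idn n).trans ((permHom P).map_idn n).symm
    | sym m n => exact (φ.map_sym m n).trans ((permHom P).map_sym m n).symm
    | comp f g h ihf ihg =>
      have e : PArr.mk ∅ (f.comp g h) = Perm.comp (PArr.mk ∅ f) (PArr.mk ∅ g) h :=
        (PArr.mk_comp f g h).symm
      refine (congrArg φ.toHom e).trans (Eq.trans ?_ (congrArg (permHom P).toHom e).symm)
      have c : ∀ ψ : PROPHom Perm P, P.cod (ψ.toHom (PArr.mk ∅ f)) =
          P.dom (ψ.toHom (PArr.mk ∅ g)) := fun ψ => by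
        exact (ψ.map_cod (PArr.mk ∅ f)).trans (Eq.trans h (ψ.map_dom (PArr.mk ∅ g)).symm)
      refine (φ.map_comp _ _ _ (c φ)).trans (Eq.trans ?_ ((permHom P).map_comp _ _ _ (c _)).symm)
      exact P.comp_congr ihf ihg _ _
    | tensor f g ihf ihg =>
      refine (map_add φ.toHom (PArr.mk ∅ f) (PArr.mk ∅ g)).trans
        (Eq.trans ?_ (map_add (permHom P).toHom (PArr.mk ∅ f) (PArr.mk ∅ g)).symm)
      exact congrArg₂ (· + ·) ihf ihg

theorem PROPHom.map_perm {P : PROP.{u}} {Q : PROP.{v}} (φ : PROPHom P Q) (p : Perm.Arr) :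
    φ.toHom ((permHom P).toHom p) = (permHom Q).toHom p := by
  refine permHom_unique (P := Q)
    { toHom := φ.toHom.comp (permHom P).toHom
      map_dom := fun f => (φ.map_dom _).trans ((permHom P).map_dom f)
      map_cod := fun f => (φ.map_cod _).trans ((permHom P).map_cod f)
      map_idn := fun n => (congrArg _ ((permHom P).map_idn n)).trans (φ.map_idn n)
      map_comp := fun f g h h' => ?_
      map_sym := fun m n => (congrArg _ ((permHom P).map_sym m n)).trans (φ.map_sym m n) } p
  have h'' : P.cod ((permHom P).toHom f) = P.dom ((permHom P).toHom g) := by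
    rw [(permHom P).map_cod, (permHom P).map_dom, h]
  exact (congrArg φ.toHom ((permHom P).map_comp f g h h'')).trans (φ.map_comp _ _ h'' h')

/-! ### The composite `T ⊗ S` over the permutations -/

/-- Composable pairs: an arrow of `T` followed by an arrow of `S` (the composite of spans of
monoids, given by pullback; the monoidal product is taken componentwise). -/
def composable (T : PROP.{u}) (S : PROP.{v}) : AddSubmonoid (T.Arr × S.Arr) where
  carrier := {x | T.cod x.1 = S.dom x.2}
  zero_mem' := by simp
  add_mem' {x y} hx hy := by
    simp only [Set.mem_ofPred_eq] at hx hy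
    simp [hx, hy]

/-- `(f ; p, g)` is related to `(f, p ; g)`, for every permutation `p`. -/
def permRel (T : PROP.{u}) (S : PROP.{v}) (x y : composable T S) : Prop :=
  ∃ (p : Perm.Arr) (h : T.cod y.1.1 = T.dom ((permHom T).toHom p))
    (h' : S.cod ((permHom S).toHom p) = S.dom x.1.2),
    x.1.1 = T.comp y.1.1 ((permHom T).toHom p) h ∧ y.1.2 = S.comp ((permHom S).toHom p) x.1.2 h'

/-- The carrier of the bimodule composite `T ⊗ S`: the coequaliser of the two actions of
permutations, i.e. the monoid of composable pairs modulo the congruence generated by `permRel`. -/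
def Tens (T : PROP.{u}) (S : PROP.{v}) : Type (max u v) := (addConGen (permRel T S)).Quotient

instance (T : PROP.{u}) (S : PROP.{v}) : AddMonoid (Tens T S) :=
  inferInstanceAs (AddMonoid (addConGen (permRel T S)).Quotient)

/-- The class `[f, g]` of a composable pair. -/
def Tens.mk {T : PROP.{u}} {S : PROP.{v}} (f : T.Arr) (g : S.Arr) (h : T.cod f = S.dom g) :
    Tens T S :=
  (addConGen (permRel T S)).mk' ⟨(f, g), h⟩

/-- Source of (the class of) a composable pair. -/
def Tens.dom (T : PROP.{u}) (S : PROP.{v}) : Tens T S →+ ℕ :=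
  (addConGen (permRel T S)).lift
    (T.dom.comp ((AddMonoidHom.fst _ _).comp (composable T S).subtype)) (by
      refine AddCon.addConGen_le.2 ?_
      rintro x y ⟨p, h, h', hx, -⟩
      change T.dom x.1.1 = T.dom y.1.1
      rw [hx, T.dom_comp])

/-- Target of (the class of) a composable pair. -/
def Tens.cod (T : PROP.{u}) (S : PROP.{v}) : Tens T S →+ ℕ :=
  (addConGen (permRel T S)).lift
    (S.cod.comp ((AddMonoidHom.snd _ _).comp (composable T S).subtype)) (by
      refine AddCon.addConGen_le.2 ?_
      rintro x y ⟨p, h, h', -, hy⟩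
      change S.cod x.1.2 = S.cod y.1.2
      rw [hy, S.cod_comp])

/-- Componentwise application of morphisms to composable pairs. -/
def composable.map {T : PROP.{u}} {S : PROP.{v}} {T' : PROP.{u}} {S' : PROP.{v}}
    (φ : PROPHom T T') (ψ : PROPHom S S') : composable T S →+ composable T' S' where
  toFun x := ⟨(φ.toHom x.1.1, ψ.toHom x.1.2), by
    change T'.cod _ = S'.dom _
    rw [φ.map_cod, ψ.map_dom]; exact x.2⟩
  map_zero' := by ext <;> simp
  map_add' x y := by ext <;> simp

/-- The map `φ ⊗ ψ : T ⊗ S → T' ⊗ S'`, sending `[f, g]` to `[φ f, ψ g]`. -/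
def Tens.map {T : PROP.{u}} {S : PROP.{v}} {T' : PROP.{u}} {S' : PROP.{v}}
    (φ : PROPHom T T') (ψ : PROPHom S S') : Tens T S →+ Tens T' S' :=
  (addConGen (permRel T S)).lift
    ((addConGen (permRel T' S')).mk'.comp (composable.map φ ψ)) (by
      refine AddCon.addConGen_le.2 ?_
      rintro x y ⟨p, h, h', hx, hy⟩
      refine (AddCon.eq _).2 (AddConGen.Rel.of _ _ ?_)
      have e₁ := φ.map_perm p
      have e₂ := ψ.map_perm p
      have k : T'.cod (φ.toHom y.1.1) = T'.dom (φ.toHom ((permHom T).toHom p)) := by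
        rw [φ.map_cod, φ.map_dom, h]
      have k' : S'.cod (ψ.toHom ((permHom S).toHom p)) = S'.dom (ψ.toHom x.1.2) := by
        rw [ψ.map_cod, ψ.map_dom, h']
      refine ⟨p, e₁ ▸ k, e₂ ▸ k', ?_, ?_⟩
      · change φ.toHom x.1.1 = _
        rw [hx, φ.map_comp _ _ _ k]
        exact T'.comp_congr rfl e₁ _ _
      · change ψ.toHom y.1.2 = _
        rw [hy, ψ.map_comp _ _ _ k']
        exact S'.comp_congr e₂ rfl _ _)

/-! ### Distributive laws -/

/-- A distributive law of PROPs `T ⊗ S → S ⊗ T`: a 2-cell between the composites over the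
permutations (a morphism of spans of monoids, compatible with the left and right actions of the
permutations) that is compatible with the units and the multiplications of `T` and `S`. The
diagrams are written elementwise, through representatives `[g₁, f₁]` of the values of the law. -/
@[ext]
structure DistributiveLaw (T : PROP.{u}) (S : PROP.{v}) where
  toHom : Tens T S →+ Tens S T
  map_dom : ∀ x, Tens.dom S T (toHom x) = Tens.dom T S x
  map_cod : ∀ x, Tens.cod S T (toHom x) = Tens.cod T S x
  /-- if `[f, g] ↦ [g₁, f₁]` then `[p ; f, g] ↦ [p ; g₁, f₁]` for permutations `p` -/
  map_left_perm : ∀ (p : Perm.Arr) (f : T.Arr) (g : S.Arr) (g₁ : S.Arr) (f₁ : T.Arr)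
    (h : T.cod f = S.dom g) (h₁ : S.cod g₁ = T.dom f₁)
    (hp : T.cod ((permHom T).toHom p) = T.dom f) (hp₁ : S.cod ((permHom S).toHom p) = S.dom g₁),
    toHom (.mk f g h) = .mk g₁ f₁ h₁ →
    toHom (.mk (T.comp ((permHom T).toHom p) f hp) g ((T.cod_comp _ _ _).trans h)) =
      .mk (S.comp ((permHom S).toHom p) g₁ hp₁) f₁ ((S.cod_comp _ _ _).trans h₁)
  /-- if `[f, g] ↦ [g₁, f₁]` then `[f, g ; p] ↦ [g₁, f₁ ; p]` for permutations `p` -/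
  map_right_perm : ∀ (p : Perm.Arr) (f : T.Arr) (g : S.Arr) (g₁ : S.Arr) (f₁ : T.Arr)
    (h : T.cod f = S.dom g) (h₁ : S.cod g₁ = T.dom f₁)
    (hp : S.cod g = S.dom ((permHom S).toHom p)) (hp₁ : T.cod f₁ = T.dom ((permHom T).toHom p)),
    toHom (.mk f g h) = .mk g₁ f₁ h₁ →
    toHom (.mk f (S.comp g ((permHom S).toHom p) hp) (h.trans (S.dom_comp _ _ _).symm)) =
      .mk g₁ (T.comp f₁ ((permHom T).toHom p) hp₁) (h₁.trans (T.dom_comp _ _ _).symm)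
  /-- `[f, id] ↦ [id, f]` -/
  map_unit_right : ∀ f : T.Arr,
    toHom (.mk f (S.idn (T.cod f)) (S.dom_idn _).symm) = .mk (S.idn (T.dom f)) f (S.cod_idn _)
  /-- `[id, g] ↦ [g, id]` -/
  map_unit_left : ∀ g : S.Arr,
    toHom (.mk (T.idn (S.dom g)) g (T.cod_idn _)) = .mk g (T.idn (S.cod g)) (T.dom_idn _).symm
  /-- if `[f, g] ↦ [g₁, f₁]` and `[f₁, g'] ↦ [g₂, f₂]` then `[f, g ; g'] ↦ [g₁ ; g₂, f₂]` -/
  map_mul_right : ∀ (f : T.Arr) (g g' : S.Arr) (g₁ : S.Arr) (f₁ : T.Arr) (g₂ : S.Arr) (f₂ : T.Arr)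
    (h : T.cod f = S.dom g) (h' : S.cod g = S.dom g') (h₁ : S.cod g₁ = T.dom f₁)
    (h₁' : T.cod f₁ = S.dom g') (h₂ : S.cod g₂ = T.dom f₂) (h₂' : S.cod g₁ = S.dom g₂),
    toHom (.mk f g h) = .mk g₁ f₁ h₁ → toHom (.mk f₁ g' h₁') = .mk g₂ f₂ h₂ →
    toHom (.mk f (S.comp g g' h') (h.trans (S.dom_comp _ _ _).symm)) =
      .mk (S.comp g₁ g₂ h₂') f₂ ((S.cod_comp _ _ _).trans h₂)
  /-- if `[f', g] ↦ [g₁, f₁]` and `[f, g₁] ↦ [g₂, f₂]` then `[f ; f', g] ↦ [g₂, f₂ ; f₁]` -/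
  map_mul_left : ∀ (f f' : T.Arr) (g : S.Arr) (g₁ : S.Arr) (f₁ : T.Arr) (g₂ : S.Arr) (f₂ : T.Arr)
    (h : T.cod f' = S.dom g) (h' : T.cod f = T.dom f') (h₁ : S.cod g₁ = T.dom f₁)
    (h₁' : T.cod f = S.dom g₁) (h₂ : S.cod g₂ = T.dom f₂) (h₂' : T.cod f₂ = T.dom f₁),
    toHom (.mk f' g h) = .mk g₁ f₁ h₁ → toHom (.mk f g₁ h₁') = .mk g₂ f₂ h₂ →
    toHom (.mk (T.comp f f' h') g ((T.cod_comp _ _ _).trans h)) =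
      .mk g₂ (T.comp f₂ f₁ h₂') (h₂.trans (T.dom_comp _ _ _).symm)

/-! ### The equations encoded by a distributive law -/

/-- Renaming of generators. -/
def Term.rename {Sg : Signature.{u}} {Sg' : Signature.{v}} (ρ : ∀ n m, Sg n m → Sg' n m) :
    ∀ {a b : ℕ}, Term Sg a b → Term Sg' a b
  | _, _, .gen s => .gen (ρ _ _ s)
  | _, _, .idn n => .idn n
  | _, _, .sym m n => .sym m n
  | _, _, .comp f g h => .comp (f.rename ρ) (g.rename ρ) h
  | _, _, .tensor f g => .tensor (f.rename ρ) (g.rename ρ)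

/-- Terms over `Sg` as terms over `Sg ⊎ Sg'`. -/
def Term.inl {Sg : Signature.{u}} (Sg' : Signature.{v}) {a b : ℕ} (t : Term Sg a b) :
    Term (Sg.sum Sg') a b := t.rename fun _ _ => Sum.inl

/-- Terms over `Sg'` as terms over `Sg ⊎ Sg'`. -/
def Term.inr (Sg : Signature.{u}) {Sg' : Signature.{v}} {a b : ℕ} (t : Term Sg' a b) :
    Term (Sg.sum Sg') a b := t.rename fun _ _ => Sum.inr

/-- The equations `E ⊎ F` over `Sg ⊎ Sg'`. -/
def sumEqs {Sg : Signature.{u}} {Sg' : Signature.{v}} (E : Set (Equation Sg))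
    (F : Set (Equation Sg')) : Set (Equation (Sg.sum Sg')) :=
  (fun e : Equation Sg => ⟨e.src, e.tgt, e.lhs.inl Sg', e.rhs.inl Sg'⟩) '' E ∪
    (fun e : Equation Sg' => ⟨e.src, e.tgt, e.lhs.inr Sg, e.rhs.inr Sg⟩) '' F

/-- The set of equations `E_λ` encoded by a distributive law `λ : T ⊗ S → S ⊗ T`, where `T` is
generated by `(Sg, E)` and `S` is presented by `(SgS, ES)`: the (directed) equations
`s ; t ≈ t' ; s'` between terms over `Sg ⊎ SgS` such that `λ` maps `[s, t]` to `[t', s']`. -/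
def lawEqs {Sg : Signature.{u}} {E : Set (Equation Sg)} {S : PROP.{v}} {SgS : Signature.{w}}
    {ES : Set (Equation SgS)} (lam : DistributiveLaw (presented Sg E) S)
    (π : PresentedBy S SgS ES) : Set (Equation (Sg.sum SgS)) :=
  {e | ∃ (a b c b' : ℕ) (s : Term Sg a b) (t : Term SgS b c) (t' : Term SgS a b')
      (s' : Term Sg b' c) (h : (presented Sg E).cod (cls E s) = S.dom (π.hom.toHom (cls ES t)))
      (h' : S.cod (π.hom.toHom (cls ES t')) = (presented Sg E).dom (cls E s')),
      lam.toHom (.mk (cls E s) (π.hom.toHom (cls ES t)) h) =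
        .mk (π.hom.toHom (cls ES t')) (cls E s') h' ∧
      e = ⟨a, c, (s.inl SgS).comp (t.inr Sg) rfl, (t'.inr Sg).comp (s'.inl SgS) rfl⟩}

/-- A set of equations, read modulo the equations `F`: the set of the pairs
`(lhs, rhs)` of terms modulo `F`. -/
def eqsModulo {Sg : Signature.{u}} (F : Set (Equation Sg)) (A : Set (Equation Sg)) :
    Set ((presented Sg F).Arr × (presented Sg F).Arr) :=
  (fun e => (cls F e.lhs, cls F e.rhs)) '' A

end PROPTheory

open PROPTheory

namespace PROPTheory

/-! ### Elements of `T ⊗ S` -/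

/-! The induced law is forced. Since `q : T → T'` is surjective, every element of `T' ⊗ S` has the
form `[q f, g]`, and the only possible value there is `(S ⊗ q)(λ[f, g])`. Hypothesis 2 says exactly
that this does not depend on the lift `f`, and hypothesis 1 implies hypothesis 2 by applying `S ⊗ q`
(`DistributiveLaw.exists_quotient_hom`).

Each axiom for `λ'` comes from lifting to `T`, using the axiom of `λ` there, and pushing the result
down (`DistributiveLaw.exists_quotient`). The difficulty is that the axioms speak of arbitrary
representatives `[g₁, f₁]` of values, while lifting produces representatives of its own. Hence the
outcome must be shown to depend only on the class. This rests on `Tens.congr_of_perm`: the relation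
moving a permutation across a pair is closed under `⊕`, so equality of classes is a chain of such
moves, and invariance needs to be checked on one move only.

As for the equations, applying `S ⊗ q` shows that everything encoded by `λ` is encoded by `λ'`. For
the converse in case 1, the instance `e = id` of the hypothesis and the unit axiom give `[id, c] =
λ[c, id] = λ[d, id] = [id, d]`; hence `S ⊗ q` is injective (`Tens.map_refl_injective`) and
equalities in `S ⊗ T'` lift to `S ⊗ T`. In case 2 injectivity may fail, but two representatives of
one element of `S ⊗ T'` have equal composites in the PROP generated by `E' ⊎ E_S` (`Prov.of_mk_eq`),
so the right-hand sides agree modulo those equations. -/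

theorem permRel.add {T : PROP.{u}} {S : PROP.{v}} {x y x' y' : composable T S}
    (h : permRel T S x y) (h' : permRel T S x' y') : permRel T S (x + x') (y + y') := by
  obtain ⟨p, h₁, h₂, hx, hy⟩ := h
  obtain ⟨p', h₁', h₂', hx', hy'⟩ := h'
  have e₁ : T.cod (y.1.1 + y'.1.1) =
      T.dom ((permHom T).toHom p + (permHom T).toHom p') := by
    rw [map_add, map_add, h₁, h₁']
  have e₂ : S.cod ((permHom S).toHom p + (permHom S).toHom p') =
      S.dom (x.1.2 + x'.1.2) := by
    rw [map_add, map_add, h₂, h₂']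
  -- Two moves side by side are one move along the sum of the permutations, by interchange.
  refine ⟨p + p', ?_, ?_, ?_, ?_⟩
  · rw [map_add (permHom T).toHom]; exact e₁
  · rw [map_add (permHom S).toHom]; exact e₂
  · change x.1.1 + x'.1.1 = _
    rw [hx, hx', ← T.interchange _ _ _ _ _ _ e₁]
    exact T.comp_congr rfl (map_add _ _ _).symm _ _
  · change y.1.2 + y'.1.2 = _
    rw [hy, hy', ← S.interchange _ _ _ _ _ _ e₂]
    exact S.comp_congr (map_add _ _ _).symm rfl _ _

/-- The identity permutation is the witness. Reflexivity allows `permRel.add` to be applied with one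
summand held fixed. -/
theorem permRel.refl {T : PROP.{u}} {S : PROP.{v}} (x : composable T S) : permRel T S x x := by
  have hx : T.cod x.1.1 = S.dom x.1.2 := x.2
  have eT := (permHom T).map_idn (T.cod x.1.1)
  have eS := (permHom S).map_idn (T.cod x.1.1)
  have k₁ : T.cod x.1.1 = T.dom (T.idn (T.cod x.1.1)) := (T.dom_idn _).symm
  have k₂ : S.cod (S.idn (T.cod x.1.1)) = S.dom x.1.2 := (S.cod_idn _).trans hx
  refine ⟨Perm.idn (T.cod x.1.1), by rw [eT]; exact k₁, by rw [eS]; exact k₂, ?_, ?_⟩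
  · exact (T.comp_idn _ _ k₁).symm.trans (T.comp_congr rfl eT.symm _ _)
  · exact (S.idn_comp _ _ k₂).symm.trans (S.comp_congr eS.symm rfl _ _)

/-- The equivalence relation generated by `permRel` is already a congruence. -/
theorem eqvGen_of_addConGen {T : PROP.{u}} {S : PROP.{v}} {x y : composable T S}
    (h : addConGen (permRel T S) x y) : Relation.EqvGen (permRel T S) x y := by
  change AddConGen.Rel (permRel T S) x y at h
  induction h with
  | of x y h => exact .rel _ _ h
  | refl x => exact .refl x
  | symm _ ih => exact .symm _ _ ih
  | trans _ _ ih ih' => exact .trans _ _ _ ih ih'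
  | @add x y x' y' h₁ h₂ ih ih' =>
    clear h₁ h₂
    -- The summands are changed one at a time, `x + x'` to `y + x'` to `y + y'`, so that each stage
    -- involves a single chain of moves.
    have left : ∀ z, Relation.EqvGen (permRel T S) (x + z) (y + z) := fun z => by
      induction ih with
      | rel _ _ h => exact .rel _ _ (h.add (.refl z))
      | refl _ => exact .refl _
      | symm _ _ _ ih => exact .symm _ _ ih
      | trans _ _ _ _ _ ih ih' => exact .trans _ _ _ ih ih'
    have right : ∀ z, Relation.EqvGen (permRel T S) (z + x') (z + y') := fun z => by
      induction ih' with
      | rel _ _ h => exact .rel _ _ (permRel.add (.refl z) h)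
      | refl _ => exact .refl _
      | symm _ _ _ ih => exact .symm _ _ ih
      | trans _ _ _ _ _ ih ih' => exact .trans _ _ _ ih ih'
    exact .trans _ _ _ (left x') (right y)

theorem Tens.exists_rep {T : PROP.{u}} {S : PROP.{v}} (x : Tens T S) :
    ∃ (f : T.Arr) (g : S.Arr) (h : T.cod f = S.dom g), x = .mk f g h := by
  induction x using AddCon.induction_on with
  | H x => exact ⟨x.1.1, x.1.2, x.2, rfl⟩

theorem Tens.mk_congr {T : PROP.{u}} {S : PROP.{v}} {f f' : T.Arr} {g g' : S.Arr}
    (hf : f = f') (hg : g = g') (h : T.cod f = S.dom g) (h' : T.cod f' = S.dom g') :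
    Tens.mk f g h = .mk f' g' h' := by
  subst hf; subst hg; rfl

theorem Tens.mk_add_mk {T : PROP.{u}} {S : PROP.{v}} {f f' : T.Arr} {g g' : S.Arr}
    (h : T.cod f = S.dom g) (h' : T.cod f' = S.dom g') :
    Tens.mk f g h + .mk f' g' h' =
      .mk (f + f') (g + g') (by rw [map_add, map_add, h, h']) := rfl

theorem Tens.dom_mk {T : PROP.{u}} {S : PROP.{v}} {f : T.Arr} {g : S.Arr}
    (h : T.cod f = S.dom g) : Tens.dom T S (.mk f g h) = T.dom f := rfl

theorem Tens.cod_mk {T : PROP.{u}} {S : PROP.{v}} {f : T.Arr} {g : S.Arr}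
    (h : T.cod f = S.dom g) : Tens.cod T S (.mk f g h) = S.cod g := rfl

theorem Tens.mk_perm {T : PROP.{u}} {S : PROP.{v}} (p : Perm.Arr) (f : T.Arr) (g : S.Arr)
    (h : T.cod f = T.dom ((permHom T).toHom p)) (h' : S.cod ((permHom S).toHom p) = S.dom g)
    (k : T.cod (T.comp f ((permHom T).toHom p) h) = S.dom g)
    (k' : T.cod f = S.dom (S.comp ((permHom S).toHom p) g h')) :
    Tens.mk (T.comp f ((permHom T).toHom p) h) g k =
      .mk f (S.comp ((permHom S).toHom p) g h') k' :=
  (AddCon.eq _).2 (AddConGen.Rel.of _ _ ⟨p, h, h', rfl, rfl⟩)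

/-- A function of composable pairs (with prescribed outer types) that does not distinguish
`(f ; p, g)` from `(f, p ; g)` depends only on the class `[f, g]`. -/
theorem Tens.congr_of_perm {T : PROP.{u}} {S : PROP.{v}} {α : Sort*} {a b : ℕ}
    (F : ∀ (f : T.Arr) (g : S.Arr), T.cod f = S.dom g → T.dom f = a → S.cod g = b → α)
    (hF : ∀ (p : Perm.Arr) (f : T.Arr) (g : S.Arr)
      (h : T.cod f = T.dom ((permHom T).toHom p)) (h' : S.cod ((permHom S).toHom p) = S.dom g)
      (k : T.cod (T.comp f ((permHom T).toHom p) h) = S.dom g)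
      (k' : T.cod f = S.dom (S.comp ((permHom S).toHom p) g h')) (ha ha' hb hb'),
      F (T.comp f ((permHom T).toHom p) h) g k ha hb =
        F f (S.comp ((permHom S).toHom p) g h') k' ha' hb')
    {f f' : T.Arr} {g g' : S.Arr} {h : T.cod f = S.dom g} {h' : T.cod f' = S.dom g'}
    (e : Tens.mk f g h = .mk f' g' h') (ha : T.dom f = a) (ha' : T.dom f' = a)
    (hb : S.cod g = b) (hb' : S.cod g' = b) : F f g h ha hb = F f' g' h' ha' hb' := by
  -- The equality of outer types is carried along the chain, since `F` can be evaluated at an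
  -- intermediate pair only once its types are known.
  have key : ∀ x y : composable T S, Relation.EqvGen (permRel T S) x y →
      (T.dom x.1.1 = T.dom y.1.1 ∧ S.cod x.1.2 = S.cod y.1.2) ∧
      ∀ ha ha' hb hb', F x.1.1 x.1.2 x.2 ha hb = F y.1.1 y.1.2 y.2 ha' hb' := by
    intro x y h
    induction h with
    | rel x y h =>
      obtain ⟨⟨f, g⟩, k⟩ := x
      obtain ⟨⟨f', g'⟩, k'⟩ := y
      obtain ⟨p, h, h', hx, hy⟩ := h
      dsimp only at h h' hx hy
      subst hx; subst hy
      exact ⟨⟨T.dom_comp _ _ _, (S.cod_comp _ _ _).symm⟩,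
        fun ha ha' hb hb' => hF p f' g h h' k k' ha ha' hb hb'⟩
    | refl x => exact ⟨⟨rfl, rfl⟩, fun _ _ _ _ => rfl⟩
    | symm x y _ ih => exact ⟨⟨ih.1.1.symm, ih.1.2.symm⟩, fun _ _ _ _ => (ih.2 _ _ _ _).symm⟩
    | trans x y z _ _ ih ih' =>
      exact ⟨⟨ih.1.1.trans ih'.1.1, ih.1.2.trans ih'.1.2⟩, fun ha ha' hb hb' =>
        (ih.2 ha (ih.1.1.symm.trans ha) hb (ih.1.2.symm.trans hb)).trans (ih'.2 _ _ _ _)⟩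
  exact (key ⟨(f, g), h⟩ ⟨(f', g'), h'⟩ (eqvGen_of_addConGen ((AddCon.eq _).1 e))).2 ha ha' hb hb'

/-! ### Actions on `T ⊗ S` and composition in a common PROP -/

/-- The left action of `T` on `T ⊗ S` is well defined. -/
theorem Tens.comp_mk_congr {T : PROP.{u}} {S : PROP.{v}} {k : T.Arr} {f f' : T.Arr}
    {g g' : S.Arr} {h : T.cod f = S.dom g} {h' : T.cod f' = S.dom g'}
    (e : Tens.mk f g h = .mk f' g' h') (hk : T.cod k = T.dom f) (hk' : T.cod k = T.dom f')
    (l : T.cod (T.comp k f hk) = S.dom g) (l' : T.cod (T.comp k f' hk') = S.dom g') :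
    Tens.mk (T.comp k f hk) g l = .mk (T.comp k f' hk') g' l' := by
  -- Prescribing the source `T.cod k` keeps `k ; f` defined along the whole chain of
  -- representatives.
  refine Tens.congr_of_perm (a := T.cod k) (b := S.cod g)
    (fun f g h ha _ => Tens.mk (T.comp k f ha.symm) g ((T.cod_comp _ _ _).trans h))
    ?_ e hk.symm hk'.symm rfl (congrArg (Tens.cod T S) e).symm
  intro p f g h h' _ _ ha ha' _ _
  refine Eq.trans ?_ (Tens.mk_perm p (T.comp k f ha'.symm) g
    ((T.cod_comp _ _ _).trans h) h' ((T.cod_comp _ _ _).trans (by rwa [(permHom T).map_cod,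
      ← (permHom S).map_cod])) _)
  exact Tens.mk_congr (T.comp_assoc _ _ _ _ _).symm rfl _ _

/-- The right action of `S` on `T ⊗ S` is well defined. -/
theorem Tens.mk_comp_congr {T : PROP.{u}} {S : PROP.{v}} {k : S.Arr} {f f' : T.Arr}
    {g g' : S.Arr} {h : T.cod f = S.dom g} {h' : T.cod f' = S.dom g'}
    (e : Tens.mk f g h = .mk f' g' h') (hk : S.cod g = S.dom k) (hk' : S.cod g' = S.dom k)
    (l : T.cod f = S.dom (S.comp g k hk)) (l' : T.cod f' = S.dom (S.comp g' k hk')) :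
    Tens.mk f (S.comp g k hk) l = .mk f' (S.comp g' k hk') l' := by
  refine Tens.congr_of_perm (a := T.dom f) (b := S.dom k)
    (fun f g h _ hb => Tens.mk f (S.comp g k hb) (h.trans (S.dom_comp _ _ _).symm))
    ?_ e rfl (congrArg (Tens.dom T S) e).symm hk hk'
  intro p f g h h' _ _ _ _ hb _
  refine (Tens.mk_perm p f (S.comp g k hb) h (h'.trans (S.dom_comp _ _ _).symm) _
    (by rw [S.dom_comp, h, (permHom T).map_dom, (permHom S).map_dom])).trans ?_
  exact Tens.mk_congr rfl (S.comp_assoc _ _ _ _ _).symm _ _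

/-- Composing the two components after mapping them to a common PROP is well defined. -/
theorem Tens.comp_congr {T : PROP.{u}} {S : PROP.{v}} {R : PROP.{w}} (φ : PROPHom T R)
    (ψ : PROPHom S R) {f f' : T.Arr} {g g' : S.Arr} {h : T.cod f = S.dom g}
    {h' : T.cod f' = S.dom g'} (e : Tens.mk f g h = .mk f' g' h')
    (k : R.cod (φ.toHom f) = R.dom (ψ.toHom g)) (k' : R.cod (φ.toHom f') = R.dom (ψ.toHom g')) :
    R.comp (φ.toHom f) (ψ.toHom g) k = R.comp (φ.toHom f') (ψ.toHom g') k' := by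
  refine Tens.congr_of_perm (a := T.dom f) (b := S.cod g)
    (fun f g h _ _ => R.comp (φ.toHom f) (ψ.toHom g) (by rw [φ.map_cod, ψ.map_dom, h]))
    ?_ e rfl (congrArg (Tens.dom T S) e).symm rfl (congrArg (Tens.cod T S) e).symm
  intro p f g h h' _ _ _ _ _ _
  -- Both morphisms send `p` to the same permutation of `R`, so associativity in `R` moves it
  -- across.
  have e₁ := φ.map_perm p
  have e₂ := ψ.map_perm p
  have k₁ : R.cod (φ.toHom f) = R.dom (φ.toHom ((permHom T).toHom p)) := by
    rw [φ.map_cod, φ.map_dom, h]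
  have k₂ : R.cod (ψ.toHom ((permHom S).toHom p)) = R.dom (ψ.toHom g) := by
    rw [ψ.map_cod, ψ.map_dom, h']
  have k₁' : R.cod (φ.toHom f) = R.dom ((permHom R).toHom p) := e₁ ▸ k₁
  have k₂' : R.cod ((permHom R).toHom p) = R.dom (ψ.toHom g) := e₂ ▸ k₂
  refine (R.comp_congr ((φ.map_comp _ _ h k₁).trans (R.comp_congr rfl e₁ k₁ k₁')) rfl _
    ((R.cod_comp _ _ _).trans k₂')).trans ((R.comp_assoc _ _ _ _ k₂').trans
      (R.comp_congr rfl ((ψ.map_comp _ _ h' k₂).trans (R.comp_congr e₂ rfl k₂ k₂')).symm _ _))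

/-! ### Quotients of distributive laws -/

/-- If a distributive law `λ : T ⊗ S → S ⊗ T` followed by `S ⊗ q` does not distinguish arrows
of `T` that are identified by `q : T → T'`, it induces a morphism of monoids
`T' ⊗ S → S ⊗ T'`. -/
theorem DistributiveLaw.exists_quotient_hom {T T' : PROP.{u}} {S : PROP.{v}} (q : PROPHom T T')
    (hq : Function.Surjective q.toHom) (lam : DistributiveLaw T S)
    (H : ∀ (c d : T.Arr) (e : S.Arr) (hc : T.cod c = S.dom e) (hd : T.cod d = S.dom e),
      q.toHom c = q.toHom d → Tens.map (.refl S) q (lam.toHom (.mk c e hc)) =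
        Tens.map (.refl S) q (lam.toHom (.mk d e hd))) :
    ∃ μ : Tens T' S →+ Tens S T', ∀ x,
      μ (Tens.map q (.refl S) x) = Tens.map (.refl S) q (lam.toHom x) := by
  choose r hr using hq
  have hrc : ∀ x : composable T' S, T.cod (r x.1.1) = S.dom x.1.2 := fun x => by
    rw [← q.map_cod, hr]; exact x.2
  -- The section `r` need not respect `⊕` or composition; by `H` its value may be replaced by any
  -- other lift, which makes up for this.
  have key : ∀ (x : composable T' S) (f : T.Arr) (g : S.Arr) (h : T.cod f = S.dom g),
      q.toHom f = x.1.1 → g = x.1.2 →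
      Tens.map (.refl S) q (lam.toHom (.mk (r x.1.1) x.1.2 (hrc x))) =
        Tens.map (.refl S) q (lam.toHom (.mk f g h)) := by
    rintro x f g h hf rfl
    exact H _ _ _ _ _ ((hr _).trans hf.symm)
  let F : composable T' S →+ Tens S T' :=
    { toFun := fun x => Tens.map (.refl S) q (lam.toHom (.mk (r x.1.1) x.1.2 (hrc x)))
      map_zero' := by
        refine (key 0 0 0 (by simp) (map_zero _) rfl).trans ?_
        change Tens.map _ _ (lam.toHom 0) = 0
        rw [map_zero, map_zero]
      map_add' := fun x y => by
        refine (key (x + y) (r x.1.1 + r y.1.1) (x.1.2 + y.1.2)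
          (by rw [map_add, map_add, hrc, hrc]) ?_ rfl).trans ?_
        · rw [map_add, hr, hr]; rfl
        · rw [← map_add (Tens.map (.refl S) q), ← map_add lam.toHom, Tens.mk_add_mk] }
  refine ⟨(addConGen (permRel T' S)).lift F (AddCon.addConGen_le.2 ?_), fun x => ?_⟩
  · rintro ⟨⟨f, g⟩, k⟩ ⟨⟨f', g'⟩, k'⟩ ⟨p, h, h', hx, hy⟩
    dsimp only at h h' hx hy
    subst hx hy
    have e := q.map_perm p
    have h₁ : T.cod (r f') = T.dom ((permHom T).toHom p) := by
      rw [← q.map_cod, hr, h, ← e, q.map_dom]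
    have h₂ : T'.cod (q.toHom (r f')) = T'.dom (q.toHom ((permHom T).toHom p)) := by
      rw [q.map_cod, q.map_dom, h₁]
    have h₃ : T.cod (T.comp (r f') ((permHom T).toHom p) h₁) = S.dom g := by
      rw [T.cod_comp, ← q.map_cod, e, ← T'.cod_comp f' _ h]; exact k
    -- The lift of `f' ; p` is taken to be `r f' ; p`, for which moving `p` across is already an
    -- identity in `T ⊗ S`.
    refine (key _ (T.comp (r f') ((permHom T).toHom p) h₁) g h₃
      ((q.map_comp _ _ _ h₂).trans (T'.comp_congr (hr _) e _ _)) rfl).trans ?_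
    change _ = Tens.map (.refl S) q (lam.toHom _)
    congr 2
    exact Tens.mk_perm p _ _ _ h' _ _
  · obtain ⟨f, g, h, rfl⟩ := x.exists_rep
    exact key ⟨(q.toHom f, g), (q.map_cod f).trans h⟩ f g h rfl rfl

/-- A distributive law `λ : T ⊗ S → S ⊗ T` descends along a surjective morphism `q : T → T'`
as soon as `(S ⊗ q) ∘ λ` does not distinguish arrows of `T` that are identified by `q`. -/
theorem DistributiveLaw.exists_quotient {T T' : PROP.{u}} {S : PROP.{v}} (q : PROPHom T T')
    (hq : Function.Surjective q.toHom) (lam : DistributiveLaw T S)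
    (H : ∀ (c d : T.Arr) (e : S.Arr) (hc : T.cod c = S.dom e) (hd : T.cod d = S.dom e),
      q.toHom c = q.toHom d → Tens.map (.refl S) q (lam.toHom (.mk c e hc)) =
        Tens.map (.refl S) q (lam.toHom (.mk d e hd))) :
    ∃ lam' : DistributiveLaw T' S, ∀ x,
      lam'.toHom (Tens.map q (.refl S) x) = Tens.map (.refl S) q (lam.toHom x) := by
  obtain ⟨μ, hμ⟩ := lam.exists_quotient_hom q hq H
  have hmk : ∀ (f : T.Arr) (g : S.Arr) (h : T.cod f = S.dom g)
      (h' : T'.cod (q.toHom f) = S.dom g),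
      μ (.mk (q.toHom f) g h') = Tens.map (.refl S) q (lam.toHom (.mk f g h)) :=
    fun f g h _ => hμ (.mk f g h)
  -- This transports values of `λ` to values of `μ`. Together with `rep`, which supplies well-typed
  -- representatives upstairs, it reduces each axiom to the one for `λ`.
  have hlam : ∀ {f : T.Arr} {g : S.Arr} {h : T.cod f = S.dom g} {k : S.Arr} {l : T.Arr}
      {h' : S.cod k = T.dom l}, lam.toHom (.mk f g h) = .mk k l h' →
      ∀ k' : S.cod k = T'.dom (q.toHom l),
        ∀ h'', μ (.mk (q.toHom f) g h'') = .mk k (q.toHom l) k' := by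
    intro f g h k l h' e _ _
    rw [hmk f g h, e]; rfl
  have rep : ∀ (f : T.Arr) (g : S.Arr) (h : T.cod f = S.dom g), ∃ (k : S.Arr) (l : T.Arr)
      (h' : S.cod k = T.dom l), lam.toHom (.mk f g h) = .mk k l h' ∧
        S.dom k = T.dom f ∧ T.cod l = S.cod g := by
    intro f g h
    obtain ⟨k, l, h', e⟩ := (lam.toHom (.mk f g h)).exists_rep
    refine ⟨k, l, h', e, ?_, ?_⟩
    · rw [← Tens.dom_mk h', ← e, lam.map_dom, Tens.dom_mk]
    · rw [← Tens.cod_mk h', ← e, lam.map_cod, Tens.cod_mk]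
  have map_dom : ∀ x, Tens.dom S T' (μ x) = Tens.dom T' S x := by
    intro x
    obtain ⟨f', g, h, rfl⟩ := x.exists_rep
    obtain ⟨f, rfl⟩ := hq f'
    obtain ⟨k, l, h', e, hk, -⟩ := rep f g ((q.map_cod f).symm.trans h)
    rw [hlam e (h'.trans (q.map_dom l).symm), Tens.dom_mk, Tens.dom_mk, hk, q.map_dom]
  have map_cod : ∀ x, Tens.cod S T' (μ x) = Tens.cod T' S x := by
    intro x
    obtain ⟨f', g, h, rfl⟩ := x.exists_rep
    obtain ⟨f, rfl⟩ := hq f'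
    obtain ⟨k, l, h', e, -, hl⟩ := rep f g ((q.map_cod f).symm.trans h)
    rw [hlam e (h'.trans (q.map_dom l).symm), Tens.cod_mk, Tens.cod_mk, q.map_cod, hl]
  have dom_eq : ∀ {f : T'.Arr} {g : S.Arr} {h : T'.cod f = S.dom g} {k : S.Arr} {l : T'.Arr}
      {h' : S.cod k = T'.dom l}, μ (.mk f g h) = .mk k l h' → S.dom k = T'.dom f := by
    intro f g h k l h' e
    rw [← Tens.dom_mk h', ← e, map_dom, Tens.dom_mk]
  have cod_eq : ∀ {f : T'.Arr} {g : S.Arr} {h : T'.cod f = S.dom g} {k : S.Arr} {l : T'.Arr}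
      {h' : S.cod k = T'.dom l}, μ (.mk f g h) = .mk k l h' → T'.cod l = S.cod g := by
    intro f g h k l h' e
    rw [← Tens.cod_mk h', ← e, map_cod, Tens.cod_mk]
  have left_perm : ∀ (p : Perm.Arr) (f : T'.Arr) (g : S.Arr) (g₁ : S.Arr) (f₁ : T'.Arr)
      (h : T'.cod f = S.dom g) (h₁ : S.cod g₁ = T'.dom f₁)
      (hp : T'.cod ((permHom T').toHom p) = T'.dom f)
      (hp₁ : S.cod ((permHom S).toHom p) = S.dom g₁),
      μ (.mk f g h) = .mk g₁ f₁ h₁ →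
      μ (.mk (T'.comp ((permHom T').toHom p) f hp) g ((T'.cod_comp _ _ _).trans h)) =
        .mk (S.comp ((permHom S).toHom p) g₁ hp₁) f₁ ((S.cod_comp _ _ _).trans h₁) := by
    intro p f' g g₁ f₁ h h₁ hp hp₁ e
    obtain ⟨f, rfl⟩ := hq f'
    have h0 := (q.map_cod f).symm.trans h
    obtain ⟨k, l, hkl, e₁, hk, -⟩ := rep f g h0
    have ep := q.map_perm p
    have c₁ : T.cod ((permHom T).toHom p) = T.dom f := by
      rw [← q.map_dom, ← hp, ← ep, q.map_cod]
    have c₂ : S.cod ((permHom S).toHom p) = S.dom k := by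
      rw [hk, ← c₁, (permHom S).map_cod, (permHom T).map_cod]
    have c₃ : T'.cod (q.toHom ((permHom T).toHom p)) = T'.dom (q.toHom f) := by rw [ep, hp]
    have hkl' : S.cod k = T'.dom (q.toHom l) := hkl.trans (q.map_dom l).symm
    have e₂ := hlam (lam.map_left_perm p f g k l h0 hkl c₁ c₂ e₁)
      ((S.cod_comp _ _ _).trans hkl') (by rw [q.map_cod, T.cod_comp, h0])
    refine (congrArg μ (Tens.mk_congr ((T'.comp_congr ep.symm rfl _ c₃).trans
      (q.map_comp _ _ _ c₃).symm) rfl _ _)).trans (e₂.trans ?_)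
    -- The pairs `(k, q l)` and `(g₁, f₁)` are only known to have the same class, so the action must
    -- be compared on classes.
    exact Tens.comp_mk_congr ((hlam e₁ hkl' h).symm.trans e) _ _ _ _
  have right_perm : ∀ (p : Perm.Arr) (f : T'.Arr) (g : S.Arr) (g₁ : S.Arr) (f₁ : T'.Arr)
      (h : T'.cod f = S.dom g) (h₁ : S.cod g₁ = T'.dom f₁)
      (hp : S.cod g = S.dom ((permHom S).toHom p))
      (hp₁ : T'.cod f₁ = T'.dom ((permHom T').toHom p)),
      μ (.mk f g h) = .mk g₁ f₁ h₁ →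
      μ (.mk f (S.comp g ((permHom S).toHom p) hp) (h.trans (S.dom_comp _ _ _).symm)) =
        .mk g₁ (T'.comp f₁ ((permHom T').toHom p) hp₁) (h₁.trans (T'.dom_comp _ _ _).symm) := by
    intro p f' g g₁ f₁ h h₁ hp hp₁ e
    obtain ⟨f, rfl⟩ := hq f'
    have h0 := (q.map_cod f).symm.trans h
    obtain ⟨k, l, hkl, e₁, -, hl⟩ := rep f g h0
    have ep := q.map_perm p
    have c₁ : T.cod l = T.dom ((permHom T).toHom p) := by
      rw [hl, hp, (permHom S).map_dom, (permHom T).map_dom]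
    have c₃ : T'.cod (q.toHom l) = T'.dom (q.toHom ((permHom T).toHom p)) := by
      rw [q.map_cod, q.map_dom, c₁]
    have hkl' : S.cod k = T'.dom (q.toHom l) := hkl.trans (q.map_dom l).symm
    have e₂ := hlam (lam.map_right_perm p f g k l h0 hkl hp c₁ e₁)
      (by rw [q.map_dom, T.dom_comp, hkl]) (h.trans (S.dom_comp _ _ _).symm)
    have c₄ : T'.cod (q.toHom l) = T'.dom ((permHom T').toHom p) := ep ▸ c₃
    refine e₂.trans ((Tens.mk_congr rfl ((q.map_comp _ _ _ c₃).trans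
      (T'.comp_congr rfl ep _ c₄)) _ (hkl'.trans (T'.dom_comp _ _ _).symm)).trans ?_)
    exact Tens.mk_comp_congr ((hlam e₁ hkl' h).symm.trans e) _ _ _ _
  -- the value of `μ` on `[f₁, g']`, acted on by `g₁`, depends only on `[g₁, f₁]`
  have congr_right : ∀ (g' g₁ g₁' : S.Arr) (f₁ f₁' : T'.Arr) (h₁ : S.cod g₁ = T'.dom f₁)
      (h₁' : S.cod g₁' = T'.dom f₁') (c : T'.cod f₁ = S.dom g') (c' : T'.cod f₁' = S.dom g')
      (g₂ g₂' : S.Arr) (f₂ f₂' : T'.Arr) (h₂ : S.cod g₂ = T'.dom f₂)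
      (h₂' : S.cod g₂' = T'.dom f₂') (k : S.cod g₁ = S.dom g₂) (k' : S.cod g₁' = S.dom g₂'),
      Tens.mk g₁ f₁ h₁ = .mk g₁' f₁' h₁' →
      μ (.mk f₁ g' c) = .mk g₂ f₂ h₂ → μ (.mk f₁' g' c') = .mk g₂' f₂' h₂' →
      Tens.mk (S.comp g₁ g₂ k) f₂ ((S.cod_comp _ _ _).trans h₂) =
        .mk (S.comp g₁' g₂' k') f₂' ((S.cod_comp _ _ _).trans h₂') := by
    intro g' g₁ g₁' f₁ f₁' h₁ h₁' c c' g₂ g₂' f₂ f₂' h₂ h₂' k k' e e₂ e₂'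
    -- To avoid choosing a representative of `μ [y, g']`, the invariant is the set of all results of
    -- acting by `x`; it is a singleton by `Tens.comp_mk_congr`. Moving `p` across is absorbed by
    -- `left_perm`.
    have hF := Tens.congr_of_perm (T := S) (S := T') (a := S.dom g₁) (b := S.dom g')
      (fun x y hxy _ hb => {z : Tens S T' | ∃ (a : S.Arr) (b : T'.Arr) (hab : S.cod a = T'.dom b)
        (hxa : S.cod x = S.dom a), μ (.mk y g' hb) = .mk a b hab ∧
          z = .mk (S.comp x a hxa) b ((S.cod_comp _ _ _).trans hab)})
      (by
        intro p x y h h' k k' _ _ hb hb'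
        have hb0 : T'.cod y = S.dom g' := hb
        obtain ⟨a, b, hab, ea⟩ := (μ (.mk y g' hb0)).exists_rep
        have da := dom_eq ea
        have cpa : S.cod ((permHom S).toHom p) = S.dom a := by
          rw [da, ← h', (permHom S).map_cod, (permHom T').map_cod]
        have ea' := left_perm p y g' a b hb0 hab h' cpa ea
        ext z
        constructor
        · rintro ⟨a₁, b₁, hab₁, hxa, e₁, rfl⟩
          have cx : S.cod x = S.dom (S.comp ((permHom S).toHom p) a cpa) := by
            rw [S.dom_comp, h]
          refine ⟨_, _, _, cx, ea', ?_⟩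
          have hxa' : S.cod (S.comp x ((permHom S).toHom p) h) = S.dom a := by
            rw [S.cod_comp, cpa]
          refine (Tens.comp_mk_congr (e₁.symm.trans ea) hxa hxa' _
            ((S.cod_comp _ _ _).trans hab)).trans ?_
          exact Tens.mk_congr (S.comp_assoc _ _ _ _ _) rfl _ _
        · rintro ⟨a₁, b₁, hab₁, hxa, e₁, rfl⟩
          have hxa' : S.cod (S.comp x ((permHom S).toHom p) h) = S.dom a := by
            rw [S.cod_comp, cpa]
          have cx : S.cod x = S.dom (S.comp ((permHom S).toHom p) a cpa) := by
            rw [S.dom_comp, h]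
          refine ⟨a, b, hab, hxa', ea, ?_⟩
          refine (Tens.comp_mk_congr (e₁.symm.trans ea') hxa cx _
            ((S.cod_comp _ _ _).trans ((S.cod_comp _ _ _).trans hab))).trans ?_
          exact Tens.mk_congr (S.comp_assoc _ _ _ _ _).symm rfl _ _)
      e rfl (congrArg (Tens.dom S T') e).symm c c'
    have m : Tens.mk (S.comp g₁ g₂ k) f₂ ((S.cod_comp _ _ _).trans h₂) ∈ _ :=
      hF.subset ⟨g₂, f₂, h₂, k, e₂, rfl⟩
    obtain ⟨a, b, hab, hxa, ea, hz⟩ := m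
    exact hz.trans (Tens.comp_mk_congr (ea.symm.trans e₂') _ _ _ _)
  -- the value of `μ` on `[f, g₁]`, acted on by `f₁`, depends only on `[g₁, f₁]`
  have congr_left : ∀ (f f₁ f₁' : T'.Arr) (g₁ g₁' : S.Arr) (h₁ : S.cod g₁ = T'.dom f₁)
      (h₁' : S.cod g₁' = T'.dom f₁') (c : T'.cod f = S.dom g₁) (c' : T'.cod f = S.dom g₁')
      (g₂ g₂' : S.Arr) (f₂ f₂' : T'.Arr) (h₂ : S.cod g₂ = T'.dom f₂)
      (h₂' : S.cod g₂' = T'.dom f₂') (k : T'.cod f₂ = T'.dom f₁) (k' : T'.cod f₂' = T'.dom f₁'),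
      Tens.mk g₁ f₁ h₁ = .mk g₁' f₁' h₁' →
      μ (.mk f g₁ c) = .mk g₂ f₂ h₂ → μ (.mk f g₁' c') = .mk g₂' f₂' h₂' →
      Tens.mk g₂ (T'.comp f₂ f₁ k) (h₂.trans (T'.dom_comp _ _ _).symm) =
        .mk g₂' (T'.comp f₂' f₁' k') (h₂'.trans (T'.dom_comp _ _ _).symm) := by
    intro f f₁ f₁' g₁ g₁' h₁ h₁' c c' g₂ g₂' f₂ f₂' h₂ h₂' k k' e e₂ e₂'
    -- The mirror image: the set of all results of acting by `y` on `μ [f, x]`, with `right_perm`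
    -- absorbing the permutation.
    have hF := Tens.congr_of_perm (T := S) (S := T') (a := T'.cod f) (b := T'.cod f₁)
      (fun x y hxy ha _ => {z : Tens S T' | ∃ (a : S.Arr) (b : T'.Arr) (hab : S.cod a = T'.dom b)
        (hby : T'.cod b = T'.dom y), μ (.mk f x ha.symm) = .mk a b hab ∧
          z = .mk a (T'.comp b y hby) (hab.trans (T'.dom_comp _ _ _).symm)})
      (by
        intro p x y h h' k k' ha ha' _ _
        obtain ⟨a, b, hab, ea⟩ := (μ (.mk f x ha'.symm)).exists_rep
        have da := cod_eq ea
        have cpa : T'.cod b = T'.dom ((permHom T').toHom p) := by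
          rw [da, h, (permHom S).map_dom, (permHom T').map_dom]
        have ea' := right_perm p f x a b ha'.symm hab h cpa ea
        have cx : T'.cod (T'.comp b ((permHom T').toHom p) cpa) = T'.dom y := by
          rw [T'.cod_comp, h']
        have cx' : T'.cod b = T'.dom (T'.comp ((permHom T').toHom p) y h') := by
          rw [T'.dom_comp, cpa]
        ext z
        constructor
        · rintro ⟨a₁, b₁, hab₁, hby, e₁, rfl⟩
          refine ⟨a, b, hab, cx', ea, ?_⟩
          refine (Tens.mk_comp_congr (e₁.symm.trans ea') hby cx _
            (by rw [T'.dom_comp, T'.dom_comp, hab])).trans ?_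
          exact Tens.mk_congr rfl (T'.comp_assoc _ _ _ _ _) _ _
        · rintro ⟨a₁, b₁, hab₁, hby, e₁, rfl⟩
          refine ⟨_, _, _, cx, ea', ?_⟩
          refine (Tens.mk_comp_congr (e₁.symm.trans ea) hby cx' _
            (by rw [T'.dom_comp, hab])).trans ?_
          exact Tens.mk_congr rfl (T'.comp_assoc _ _ _ _ _).symm _ _)
      e c.symm c'.symm rfl (congrArg (Tens.cod S T') e).symm
    have m : Tens.mk g₂ (T'.comp f₂ f₁ k) (h₂.trans (T'.dom_comp _ _ _).symm) ∈ _ :=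
      hF.subset ⟨g₂, f₂, h₂, k, e₂, rfl⟩
    obtain ⟨a, b, hab, hby, ea, hz⟩ := m
    exact hz.trans (Tens.mk_comp_congr (ea.symm.trans e₂') _ _ _ _)
  refine ⟨{ toHom := μ, map_dom := map_dom, map_cod := map_cod, map_left_perm := left_perm,
            map_right_perm := right_perm, map_unit_right := ?_, map_unit_left := ?_,
            map_mul_right := ?_, map_mul_left := ?_ }, hμ⟩
  · intro f'
    obtain ⟨f, rfl⟩ := hq f'
    have e := hlam (lam.map_unit_right f) (by rw [S.cod_idn, q.map_dom])
      (by rw [S.dom_idn, q.map_cod])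
    refine (congrArg μ (Tens.mk_congr rfl (congrArg S.idn (q.map_cod f)) _ _)).trans (e.trans ?_)
    exact Tens.mk_congr (congrArg S.idn (q.map_dom f).symm) rfl _ _
  · intro g
    have k : T'.cod (q.toHom (T.idn (S.dom g))) = S.dom g := by rw [q.map_cod, T.cod_idn]
    have k' : S.cod g = T'.dom (q.toHom (T.idn (S.cod g))) := by rw [q.map_dom, T.dom_idn]
    have e := hlam (lam.map_unit_left g) k' k
    refine (congrArg μ (Tens.mk_congr (q.map_idn _).symm rfl _ _)).trans (e.trans ?_)
    exact Tens.mk_congr rfl (q.map_idn _) _ _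
  · intro f' g g' g₁ f₁ g₂ f₂ h h' h₁ h₁' h₂ h₂' e e'
    obtain ⟨f, rfl⟩ := hq f'
    have h0 := (q.map_cod f).symm.trans h
    obtain ⟨k, l, hkl, ek, hk, hl⟩ := rep f g h0
    have hl' : T.cod l = S.dom g' := hl.trans h'
    -- The second application of `λ` starts from the lift `l`, since `f₁` need not be `q l`;
    -- `congr_right` makes up the difference.
    obtain ⟨k₂, l₂, hkl₂, ek₂, hk₂, -⟩ := rep l g' hl'
    have c : S.cod k = S.dom k₂ := by rw [hk₂, hkl]
    have e₃ := hlam (lam.map_mul_right f g g' k l k₂ l₂ h0 h' hkl hl' hkl₂ c ek ek₂)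
      (by rw [S.cod_comp, q.map_dom, hkl₂]) (h.trans (S.dom_comp _ _ _).symm)
    have c₁ : S.cod k = T'.dom (q.toHom l) := hkl.trans (q.map_dom l).symm
    have c₂ : S.cod k₂ = T'.dom (q.toHom l₂) := hkl₂.trans (q.map_dom l₂).symm
    have c₃ : T'.cod (q.toHom l) = S.dom g' := (q.map_cod l).trans hl'
    exact e₃.trans (congr_right g' k g₁ (q.toHom l) f₁ c₁ h₁ c₃ h₁' k₂ g₂ (q.toHom l₂) f₂ c₂ h₂ c
      h₂' ((hlam ek c₁ h).symm.trans e) (hlam ek₂ c₂ c₃) e')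
  · intro φ φ' g g₁ f₁ g₂ f₂ h h' h₁ h₁' h₂ h₂' e e'
    obtain ⟨f, rfl⟩ := hq φ
    obtain ⟨f', rfl⟩ := hq φ'
    have h0 := (q.map_cod f').symm.trans h
    have hff : T.cod f = T.dom f' := by rw [← q.map_cod, h', q.map_dom]
    obtain ⟨k, l, hkl, ek, hk, hl⟩ := rep f' g h0
    have hfk : T.cod f = S.dom k := hff.trans hk.symm
    obtain ⟨k₂, l₂, hkl₂, ek₂, -, hl₂⟩ := rep f k hfk
    have c : T.cod l₂ = T.dom l := hl₂.trans hkl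
    have c₁ : S.cod k = T'.dom (q.toHom l) := hkl.trans (q.map_dom l).symm
    have c₂ : S.cod k₂ = T'.dom (q.toHom l₂) := hkl₂.trans (q.map_dom l₂).symm
    have c₃ : T'.cod (q.toHom f) = S.dom k := (q.map_cod f).trans hfk
    have c₄ : T'.cod (q.toHom l₂) = T'.dom (q.toHom l) := by rw [q.map_cod, q.map_dom, c]
    have e₃ := hlam (lam.map_mul_left f f' g k l k₂ l₂ h0 hff hkl hfk hkl₂ c ek ek₂)
      (by rw [q.map_dom, T.dom_comp, hkl₂]) (by rw [q.map_cod, T.cod_comp, h0])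
    refine (congrArg μ (Tens.mk_congr (q.map_comp f f' hff h').symm rfl _ _)).trans
      (e₃.trans ((Tens.mk_congr rfl (q.map_comp l₂ l c c₄) _
        (c₂.trans (T'.dom_comp _ _ _).symm)).trans ?_))
    exact congr_left (q.toHom f) (q.toHom l) f₁ k g₁ c₁ h₁ c₃ h₁' k₂ g₂ (q.toHom l₂) f₂ c₂ h₂ c₄
      h₂' ((hlam ek c₁ h).symm.trans e) (hlam ek₂ c₂ c₃) e'

/-! ### Injectivity of `S ⊗ q` -/

/-- If arrows identified by `q : T → T'` are already identified in `S ⊗ T`, then `S ⊗ q` is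
injective. -/
theorem Tens.map_refl_injective {T T' : PROP.{u}} {S : PROP.{v}} (q : PROPHom T T')
    (hq : Function.Surjective q.toHom)
    (H : ∀ (n : ℕ) (c d : T.Arr) (hc : S.cod (S.idn n) = T.dom c) (hd : S.cod (S.idn n) = T.dom d),
      q.toHom c = q.toHom d → Tens.mk (S.idn n) c hc = .mk (S.idn n) d hd) :
    Function.Injective (Tens.map (.refl S) q) := by
  -- Acting by `g` on the left of `[id, c] = [id, d]` gives the general case.
  have H' : ∀ (g : S.Arr) (c d : T.Arr) (hc : S.cod g = T.dom c) (hd : S.cod g = T.dom d),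
      q.toHom c = q.toHom d → Tens.mk g c hc = .mk g d hd := by
    intro g c d hc hd e
    have k : S.cod g = S.dom (S.idn (S.cod g)) := (S.dom_idn _).symm
    have e' := H (S.cod g) c d ((S.cod_idn _).trans hc) ((S.cod_idn _).trans hd) e
    have := Tens.comp_mk_congr e' k k ((S.cod_comp _ _ _).trans ((S.cod_idn _).trans hc))
      ((S.cod_comp _ _ _).trans ((S.cod_idn _).trans hd))
    simpa only [S.comp_idn] using this
  intro x y e
  obtain ⟨g, f, h, rfl⟩ := x.exists_rep
  obtain ⟨g', f', h', rfl⟩ := y.exists_rep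
  have k : S.cod g = T'.dom (q.toHom f) := h.trans (q.map_dom f).symm
  have k' : S.cod g' = T'.dom (q.toHom f') := h'.trans (q.map_dom f').symm
  have e' : Tens.mk g (q.toHom f) k = .mk g' (q.toHom f') k' := e
  -- The invariant is the set of all `[g, f]` with `f` a lift of `y`. By `H'` it has at most one
  -- element, and `p ; f` lifts `p ; y` whenever `f` lifts `y`.
  have hF := Tens.congr_of_perm (a := S.dom g) (b := T'.cod (q.toHom f))
    (fun g y _ _ _ => {z : Tens S T | ∃ (f : T.Arr) (h : S.cod g = T.dom f),
      q.toHom f = y ∧ z = .mk g f h})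
    (by
      intro p g y h h' _ k' _ _ _ _
      obtain ⟨f, rfl⟩ := hq y
      have ep := q.map_perm p
      have c : T.cod ((permHom T).toHom p) = T.dom f := by
        rw [← q.map_dom, ← h', ← ep, q.map_cod]
      have c' : T'.cod (q.toHom ((permHom T).toHom p)) = T'.dom (q.toHom f) := by rw [ep, h']
      have c₁ : S.cod (S.comp g ((permHom S).toHom p) h) = T.dom f := by
        rw [S.cod_comp, ← c, (permHom S).map_cod, (permHom T).map_cod]
      have c₂ : S.cod g = T.dom (T.comp ((permHom T).toHom p) f c) := by
        rw [T.dom_comp, h, (permHom S).map_dom, (permHom T).map_dom]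
      have eq : q.toHom (T.comp ((permHom T).toHom p) f c) =
          T'.comp ((permHom T').toHom p) (q.toHom f) h' :=
        (q.map_comp _ _ _ c').trans (T'.comp_congr ep rfl _ _)
      have em := Tens.mk_perm p g f h c c₁ c₂
      ext z
      constructor
      · rintro ⟨f₁, h₁, e₁, rfl⟩
        exact ⟨_, c₂, eq, (H' _ _ _ _ _ e₁).trans em⟩
      · rintro ⟨f₁, h₁, e₁, rfl⟩
        exact ⟨f, c₁, rfl, (H' _ _ _ _ _ (e₁.trans eq.symm)).trans em.symm⟩)
    e' rfl (congrArg (Tens.dom S T') e').symm rfl (congrArg (Tens.cod S T') e').symm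
  obtain ⟨f₁, h₁, e₁, hz⟩ := hF.subset ⟨f, h, rfl, rfl⟩
  exact hz.trans (H' _ _ _ _ _ e₁)

/-! ### Renaming of generators and equations modulo a theory -/

theorem Prov.rename {Sg : Signature.{u}} {Sg' : Signature.{v}} {E : Set (Equation Sg)}
    {F : Set (Equation Sg')} (ρ : ∀ n m, Sg n m → Sg' n m)
    (hF : ∀ e ∈ E, Prov F (e.lhs.rename ρ) (e.rhs.rename ρ)) {a b c d : ℕ} {s : Term Sg a b}
    {t : Term Sg c d} (h : Prov E s t) : Prov F (s.rename ρ) (t.rename ρ) := by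
  induction h with
  | ax e h => exact hF e h
  | refl f => exact .refl _
  | symm _ ih => exact .symm ih
  | trans _ _ ih ih' => exact .trans ih ih'
  | comp_congr h h₁ _ _ ih ih' => exact .comp_congr h h₁ ih ih'
  | tensor_congr _ _ ih ih' => exact .tensor_congr ih ih'
  | idn_comp f h => exact .idn_comp _ h
  | comp_idn f h => exact .comp_idn _ h
  | comp_assoc f g k h h' => exact .comp_assoc _ _ _ h h'
  | tensor_assoc f g k => exact .tensor_assoc _ _ _
  | zero_tensor f => exact .zero_tensor _
  | tensor_zero f => exact .tensor_zero _
  | idn_tensor m n => exact .idn_tensor m n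
  | interchange f g f₁ g₁ h h₁ h₂ => exact .interchange _ _ _ _ h h₁ h₂
  | sym_natural f g => exact .sym_natural _ _
  | sym_sym m n => exact .sym_sym m n
  | sym_zero m => exact .sym_zero m
  | sym_add m n k => exact .sym_add m n k

/-- The morphism of generated PROPs induced by a renaming of generators. -/
def renameHom {Sg : Signature.{u}} {Sg' : Signature.{v}} {E : Set (Equation Sg)}
    {F : Set (Equation Sg')} (ρ : ∀ n m, Sg n m → Sg' n m)
    (hF : ∀ e ∈ E, Prov F (e.lhs.rename ρ) (e.rhs.rename ρ)) :
    PROPHom (presented Sg E) (presented Sg' F) where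
  toHom :=
    { toFun := Quotient.map (fun s => ⟨s.src, s.tgt, s.term.rename ρ⟩)
        (fun _ _ h => Prov.rename ρ hF h)
      map_zero' := rfl
      map_add' := fun x y => by
        induction x using PArr.ind; induction y using PArr.ind; rfl }
  map_dom f := by induction f using PArr.ind; rfl
  map_cod f := by induction f using PArr.ind; rfl
  map_idn _ := rfl
  map_comp f g h h' := by
    induction f using PArr.ind; induction g using PArr.ind
    refine (congrArg _ (PArr.mk_comp_of _ _ h)).trans ?_
    exact (PArr.mk_comp _ _ h).symm
  map_sym _ _ := rfl

/-- Composite of morphisms of PROPs. -/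
def PROPHom.trans {P : PROP.{u}} {Q : PROP.{v}} {R : PROP.{w}} (φ : PROPHom P Q)
    (ψ : PROPHom Q R) : PROPHom P R where
  toHom := ψ.toHom.comp φ.toHom
  map_dom f := (ψ.map_dom _).trans (φ.map_dom f)
  map_cod f := (ψ.map_cod _).trans (φ.map_cod f)
  map_idn n := (congrArg _ (φ.map_idn n)).trans (ψ.map_idn n)
  map_comp f g h h' := by
    have h'' : Q.cod (φ.toHom f) = Q.dom (φ.toHom g) := by rw [φ.map_cod, φ.map_dom, h]
    exact (congrArg ψ.toHom (φ.map_comp f g h h'')).trans (ψ.map_comp _ _ h'' h')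
  map_sym m n := (congrArg _ (φ.map_sym m n)).trans (ψ.map_sym m n)

/-- The inverse of a bijective morphism of PROPs. -/
noncomputable def PROPHom.symm {P : PROP.{u}} {Q : PROP.{v}} (φ : PROPHom P Q)
    (hφ : Function.Bijective φ.toHom) : PROPHom Q P where
  toHom := (AddEquiv.ofBijective φ.toHom hφ).symm.toAddMonoidHom
  map_dom f := by
    obtain ⟨f, rfl⟩ := hφ.2 f
    exact (congrArg P.dom ((AddEquiv.ofBijective φ.toHom hφ).symm_apply_apply f)).trans
      (φ.map_dom f).symm
  map_cod f := by
    obtain ⟨f, rfl⟩ := hφ.2 f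
    exact (congrArg P.cod ((AddEquiv.ofBijective φ.toHom hφ).symm_apply_apply f)).trans
      (φ.map_cod f).symm
  map_idn n := by
    rw [← φ.map_idn]
    exact (AddEquiv.ofBijective φ.toHom hφ).symm_apply_apply _
  map_comp f g h h' := by
    obtain ⟨f, rfl⟩ := hφ.2 f
    obtain ⟨g, rfl⟩ := hφ.2 g
    have k : P.cod f = P.dom g := by rw [← φ.map_cod, h, φ.map_dom]
    have e : ∀ x, (AddEquiv.ofBijective φ.toHom hφ).symm (φ.toHom x) = x :=
      (AddEquiv.ofBijective φ.toHom hφ).symm_apply_apply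
    rw [← φ.map_comp f g k h]
    exact (e _).trans (P.comp_congr (e f).symm (e g).symm _ _)
  map_sym m n := by
    rw [← φ.map_sym]
    exact (AddEquiv.ofBijective φ.toHom hφ).symm_apply_apply _

theorem PROPHom.symm_apply {P : PROP.{u}} {Q : PROP.{v}} (φ : PROPHom P Q)
    (hφ : Function.Bijective φ.toHom) (x : P.Arr) : (φ.symm hφ).toHom (φ.toHom x) = x :=
  (AddEquiv.ofBijective φ.toHom hφ).symm_apply_apply x

/-- Terms `t ; s` representing the same element of `S ⊗ T` are equal modulo the equations of
`S` and of `T`. -/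
theorem Prov.of_mk_eq {Sg : Signature.{u}} {F : Set (Equation Sg)} {S : PROP.{v}}
    {SgS : Signature.{w}} {ES : Set (Equation SgS)} (π : PresentedBy S SgS ES)
    {a b c a' b' c' : ℕ} {t : Term SgS a b} {s : Term Sg b c} {t' : Term SgS a' b'}
    {s' : Term Sg b' c'} {h : S.cod (π.hom.toHom (cls ES t)) = (presented Sg F).dom (cls F s)}
    {h' : S.cod (π.hom.toHom (cls ES t')) = (presented Sg F).dom (cls F s')}
    (e : Tens.mk (π.hom.toHom (cls ES t)) (cls F s) h =
      .mk (π.hom.toHom (cls ES t')) (cls F s') h') :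
    Prov (sumEqs F ES) ((t.inr Sg).comp (s.inl SgS) rfl) ((t'.inr Sg).comp (s'.inl SgS) rfl) := by
  -- Both PROPs map to the one generated by the disjoint union of the theories, `S` through the
  -- inverse of its presentation. Composing there is well defined on `S ⊗ T` by `Tens.comp_congr`.
  let φ : PROPHom (presented Sg F) (presented (Sg.sum SgS) (sumEqs F ES)) :=
    renameHom (fun _ _ => Sum.inl) fun e he =>
      Prov.ax (⟨e.src, e.tgt, e.lhs.inl SgS, e.rhs.inl SgS⟩ : Equation (Sg.sum SgS))
        (Or.inl ⟨e, he, rfl⟩)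
  let ψ₀ : PROPHom (presented SgS ES) (presented (Sg.sum SgS) (sumEqs F ES)) :=
    renameHom (fun _ _ => Sum.inr) fun e he =>
      Prov.ax (⟨e.src, e.tgt, e.lhs.inr Sg, e.rhs.inr Sg⟩ : Equation (Sg.sum SgS))
        (Or.inr ⟨e, he, rfl⟩)
  let ψ : PROPHom S (presented (Sg.sum SgS) (sumEqs F ES)) := (π.hom.symm π.bijective).trans ψ₀
  have hψ : ∀ {a b : ℕ} (t : Term SgS a b),
      ψ.toHom (π.hom.toHom (cls ES t)) = cls (sumEqs F ES) (t.inr Sg) := fun t =>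
    congrArg ψ₀.toHom (π.hom.symm_apply π.bijective (cls ES t))
  have k : ∀ {a b c : ℕ} (t : Term SgS a b) (s : Term Sg b c),
      (presented (Sg.sum SgS) (sumEqs F ES)).cod (ψ.toHom (π.hom.toHom (cls ES t))) =
        (presented (Sg.sum SgS) (sumEqs F ES)).dom (φ.toHom (cls F s)) := by
    intro a b c t s
    rw [hψ]; rfl
  have val : ∀ {a b c : ℕ} (t : Term SgS a b) (s : Term Sg b c),
      (presented (Sg.sum SgS) (sumEqs F ES)).comp (ψ.toHom (π.hom.toHom (cls ES t)))
        (φ.toHom (cls F s)) (k t s) =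
      cls (sumEqs F ES) ((t.inr Sg).comp (s.inl SgS) rfl) := by
    intro a b c t s
    exact (PROP.comp_congr _ (hψ t) rfl _ rfl).trans (PArr.mk_comp _ _ rfl)
  exact PArr.mk_eq.1 ((val t s).symm.trans ((Tens.comp_congr ψ φ e (k t s) (k t' s')).trans
    (val t' s')))

/-! ### Encoded equations and the quotient morphism -/

theorem quotHom_surjective {Sg : Signature.{u}} {E E' : Set (Equation Sg)} (hE : E ⊆ E') :
    Function.Surjective (quotHom hE).toHom := by
  intro x
  induction x using PArr.ind with
  | h t => exact ⟨cls E t, rfl⟩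

/-- Arrows identified by the quotient morphism are represented by terms equal modulo `E'`. -/
theorem quotHom_cases {Sg : Signature.{u}} {E E' : Set (Equation Sg)} (hE : E ⊆ E')
    {P : PArr Sg E → PArr Sg E → Prop}
    (h : ∀ (a b : ℕ) (c d : Term Sg a b), Prov E' c d → P (cls E c) (cls E d))
    (x y : (presented Sg E).Arr) (e : (quotHom hE).toHom x = (quotHom hE).toHom y) : P x y := by
  induction x using PArr.ind with
  | h s =>
    induction y using PArr.ind with
    | h t =>
      have p := PArr.mk_eq.1 e
      obtain ⟨rfl, rfl⟩ := p.typ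
      exact h _ _ _ _ p

/-- A law encodes its equations through any induced law on a quotient. -/
theorem lawEqs_subset {Sg : Signature.{u}} {E E' : Set (Equation Sg)} (hE : E ⊆ E')
    {S : PROP.{v}} (lam : DistributiveLaw (presented Sg E) S)
    (lam' : DistributiveLaw (presented Sg E') S)
    (H : ∀ x, lam'.toHom (Tens.map (quotHom hE) (.refl S) x) =
      Tens.map (.refl S) (quotHom hE) (lam.toHom x))
    {SgS : Signature.{w}} {ES : Set (Equation SgS)} (π : PresentedBy S SgS ES) :
    lawEqs lam π ⊆ lawEqs lam' π := by
  rintro _ ⟨a, b, c, b', s, t, t', s', h, h', e, rfl⟩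
  -- The quotient morphism sends the class of a term to the class of the same term, so the same four
  -- terms serve.
  exact ⟨a, b, c, b', s, t, t', s', h, h', (H (.mk (cls E s) _ h)).trans (congrArg _ e), rfl⟩

/-- Modulo `E' ⊎ ES`, an equation encoded by the induced law is encoded by the law itself. -/
theorem eqsModulo_lawEqs_subset {Sg : Signature.{u}} {E E' : Set (Equation Sg)} (hE : E ⊆ E')
    {S : PROP.{v}} (lam : DistributiveLaw (presented Sg E) S)
    (lam' : DistributiveLaw (presented Sg E') S)
    (H : ∀ x, lam'.toHom (Tens.map (quotHom hE) (.refl S) x) =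
      Tens.map (.refl S) (quotHom hE) (lam.toHom x))
    {SgS : Signature.{w}} {ES : Set (Equation SgS)} (π : PresentedBy S SgS ES) :
    eqsModulo (sumEqs E' ES) (lawEqs lam' π) ⊆ eqsModulo (sumEqs E' ES) (lawEqs lam π) := by
  rintro _ ⟨_, ⟨a, b, c, b', s, t, t', s', h, h', e, rfl⟩, rfl⟩
  -- The value of `λ` itself is represented by terms `t₁`, `s₁`, which may differ from `t'`, `s'`.
  -- The encoded equation for them has literally the same left-hand side.
  obtain ⟨k, l, hkl, e₁⟩ := (lam.toHom (.mk (cls E s) (π.hom.toHom (cls ES t)) h)).exists_rep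
  obtain ⟨k, rfl⟩ := π.bijective.2 k
  have hdom : S.dom (π.hom.toHom k) = a :=
    (congrArg (Tens.dom _ _) e₁).symm.trans (lam.map_dom _)
  have hcod : (presented Sg E).cod l = c :=
    (congrArg (Tens.cod _ _) e₁).symm.trans ((lam.map_cod _).trans (π.hom.map_cod _))
  rw [π.hom.map_dom] at hdom
  induction k using PArr.ind with
  | @h a₁ b₁ t₁ =>
    induction l using PArr.ind with
    | @h b₂ c₁ s₁ =>
      have hb : b₁ = b₂ := (π.hom.map_cod _).symm.trans hkl
      obtain rfl : a₁ = a := hdom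
      obtain rfl : c₁ = c := hcod
      subst hb
      refine ⟨_, ⟨_, b, _, _, s, t, t₁, s₁, h, hkl, e₁, rfl⟩, Prod.ext rfl ?_⟩
      refine PArr.mk_eq.2 (Prov.of_mk_eq (h := hkl) (h' := h') π ?_)
      exact (congrArg (Tens.map (.refl S) (quotHom hE)) e₁).symm.trans
        ((H (.mk (cls E s) _ h)).symm.trans e)

end PROPTheory

/-! ### The proposition -/

theorem mainTheorem6 {Sg : Signature.{u}} {E E' : Set (Equation Sg)} (hE : E ⊆ E')
    (S : PROP.{v}) (lam : DistributiveLaw (presented Sg E) S) :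
    -- equal results in `S ⊗ T`
    ((∀ (a b : ℕ) (c d : Term Sg a b) (e : S.Arr)
        (hc : (presented Sg E).cod (cls E c) = S.dom e)
        (hd : (presented Sg E).cod (cls E d) = S.dom e),
        Prov E' c d → lam.toHom (.mk (cls E c) e hc) = lam.toHom (.mk (cls E d) e hd)) →
      ∃ lam' : DistributiveLaw (presented Sg E') S,
        (∀ x, lam'.toHom (Tens.map (quotHom hE) (.refl S) x) =
          Tens.map (.refl S) (quotHom hE) (lam.toHom x)) ∧
        ∀ (SgS : Signature.{w}) (ES : Set (Equation SgS)) (π : PresentedBy S SgS ES),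
          lawEqs lam' π = lawEqs lam π) ∧
    -- equal results modulo `E'`, i.e. in `S ⊗ T'`
    ((∀ (a b : ℕ) (c d : Term Sg a b) (e : S.Arr)
        (hc : (presented Sg E).cod (cls E c) = S.dom e)
        (hd : (presented Sg E).cod (cls E d) = S.dom e),
        Prov E' c d →
          Tens.map (.refl S) (quotHom hE) (lam.toHom (.mk (cls E c) e hc)) =
            Tens.map (.refl S) (quotHom hE) (lam.toHom (.mk (cls E d) e hd))) →
      ∃ lam' : DistributiveLaw (presented Sg E') S,
        (∀ x, lam'.toHom (Tens.map (quotHom hE) (.refl S) x) =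
          Tens.map (.refl S) (quotHom hE) (lam.toHom x)) ∧
        ∀ (SgS : Signature.{w}) (ES : Set (Equation SgS)) (π : PresentedBy S SgS ES),
          eqsModulo (sumEqs E' ES) (lawEqs lam' π) =
            eqsModulo (sumEqs E' ES) (lawEqs lam π)) := by
  -- Both parts construct `λ'` from the weaker hypothesis, restated here for arrows. The typing
  -- proofs are quantified inside `P` because they depend on the arrows being replaced by terms.
  have law := fun (H : ∀ (a b : ℕ) (c d : Term Sg a b) (e : S.Arr)
      (hc : (presented Sg E).cod (cls E c) = S.dom e)
      (hd : (presented Sg E).cod (cls E d) = S.dom e), Prov E' c d →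
        Tens.map (.refl S) (quotHom hE) (lam.toHom (.mk (cls E c) e hc)) =
          Tens.map (.refl S) (quotHom hE) (lam.toHom (.mk (cls E d) e hd))) =>
    lam.exists_quotient (quotHom hE) (quotHom_surjective hE) fun x y e hx hy exy =>
      quotHom_cases hE (P := fun x y => ∀ (hx : PArr.cod x = S.dom e) (hy : PArr.cod y = S.dom e),
        Tens.map (.refl S) (quotHom hE)
            (lam.toHom (Tens.mk (T := presented Sg E) (S := S) x e hx)) =
          Tens.map (.refl S) (quotHom hE)
            (lam.toHom (Tens.mk (T := presented Sg E) (S := S) y e hy)))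
        (fun a b c d p hc hd => H a b c d e hc hd p) x y exy hx hy
  refine ⟨fun H => ?_, fun H => ?_⟩
  · obtain ⟨lam', hlam'⟩ := law fun a b c d e hc hd p => congrArg _ (H a b c d e hc hd p)
    have inj : Function.Injective (Tens.map (.refl S) (quotHom hE)) := by
      refine Tens.map_refl_injective (quotHom hE) (quotHom_surjective hE) fun n x y hx hy exy => ?_
      refine quotHom_cases hE (P := fun x y => ∀ (hx : S.cod (S.idn n) = PArr.dom x)
        (hy : S.cod (S.idn n) = PArr.dom y),
        Tens.mk (S := presented Sg E) (S.idn n) x hx = .mk (S.idn n) y hy)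
        (fun a b c d p hc hd => ?_) x y exy hx hy
      obtain rfl : n = a := (S.cod_idn n).symm.trans hc
      -- Taking `e` to be an identity turns the hypothesis on `λ` into an identification inside `S ⊗
      -- T`.
      exact (lam.map_unit_right (cls E c)).symm.trans
        ((H _ _ c d _ _ _ p).trans (lam.map_unit_right (cls E d)))
    refine ⟨lam', hlam', fun SgS ES π =>
      Set.Subset.antisymm ?_ (lawEqs_subset hE lam lam' hlam' π)⟩
    rintro _ ⟨a, b, c, b', s, t, t', s', h, h', e, rfl⟩
    exact ⟨a, b, c, b', s, t, t', s', h, h',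
      inj ((hlam' (.mk (cls E s) _ h)).symm.trans e), rfl⟩
  · obtain ⟨lam', hlam'⟩ := law H
    exact ⟨lam', hlam', fun SgS ES π => Set.Subset.antisymm
      (eqsModulo_lawEqs_subset hE lam lam' hlam' π)
      (Set.image_mono (lawEqs_subset hE lam lam' hlam' π))⟩
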